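/- Consider the Lorenz system $$\dot x_1=\sigma(x_2-x_1),\qquad \dot x_2=x_1(\rho-x_3)-x_2,\qquad \dot x_3=x_1x_2-\beta x_3$$ on $\mathbb{R}^3$ with $\sigma=10$ and $\beta=8/3$. For every $\rho\in[0,12]$ the system is globally stable: for every initial state $x_0\in\mathbb{R}^3$ there is a trajectory with $x(0)=x_0$ defined for all $t\ge 0$, and every trajectory on $[0,\infty)$ converges, as $t\to\infty$, to one of the equilibria (stationary points) of the system. In particular, the system has no periodic orbits (no non-constant periodic trajectories), and it has no chaos in the sense of Devaney: there is no nonempty forward-invariant set $\Lambda\subseteq\mathbb{R}^3$ such that the dynamics restricted to $\Lambda$ is topologically transitive, has dense periodic points (equilibria being counted as periodic), and depends sensitively on initial conditions. -/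

import Mathlib

open Set Filter Topology

/-- The right-hand side of the Lorenz equations
`x₁' = σ (x₂ - x₁)`, `x₂' = x₁ (ρ - x₃) - x₂`, `x₃' = x₁ x₂ - β x₃`
(coordinates are numbered `0, 1, 2`). -/
noncomputable def lorenzField (σ β ρ : ℝ) (x : EuclideanSpace ℝ (Fin 3)) :
    EuclideanSpace ℝ (Fin 3) :=
  !₂[σ * (x 1 - x 0), x 0 * (ρ - x 2) - x 1, x 0 * x 1 - β * x 2]

section AutonomousODE

variable {E : Type*} [NormedAddCommGroup E] [NormedSpace ℝ E]

/-- The curve `x` is a forward trajectory of `x' = f(x)`, defined for all times `t ≥ 0`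
(one-sided derivative at `t = 0`). The values of `x` at negative times are irrelevant. -/
def IsTrajectory (f : E → E) (x : ℝ → E) : Prop :=
  IsIntegralCurveOn x (fun _ => f) (Ici 0)

/-- The set of equilibria (stationary points) of `x' = f(x)`. -/
def equilibria (f : E → E) : Set E := {e | f e = 0}

/-- Global stability of `x' = f(x)`: from every initial state there starts a trajectory that is
defined for all forward times (no solution escapes to infinity), and every trajectory converges to
one of the equilibria. -/
structure GloballyStable (f : E → E) : Prop where
  exists_trajectory : ∀ x₀ : E, ∃ x : ℝ → E, IsTrajectory f x ∧ x 0 = x₀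
  converges : ∀ x : ℝ → E, IsTrajectory f x → ∃ e ∈ equilibria f, Tendsto x atTop (𝓝 e)

/-- The trajectory `x` is periodic: it repeats itself after some time `T > 0`
(constant trajectories are included). -/
def IsPeriodicTrajectory (f : E → E) (x : ℝ → E) : Prop :=
  IsTrajectory f x ∧ ∃ T : ℝ, 0 < T ∧ ∀ t : ℝ, 0 ≤ t → x (t + T) = x t

/-- The trajectory `x` traces a periodic orbit: it is periodic and not constant. -/
def IsPeriodicOrbit (f : E → E) (x : ℝ → E) : Prop :=
  IsPeriodicTrajectory f x ∧ ∃ t : ℝ, 0 ≤ t ∧ x t ≠ x 0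

/-- The points of `Λ` that lie on a periodic trajectory (equilibria are periodic points). -/
def periodicPointsIn (f : E → E) (Λ : Set E) : Set E :=
  {p | p ∈ Λ ∧ ∃ x : ℝ → E, IsPeriodicTrajectory f x ∧ x 0 = p}

/-- `Λ` is a chaotic set of `x' = f(x)` in the sense of Devaney: it is nonempty and forward
invariant, and the dynamics restricted to `Λ` is topologically transitive, has dense periodic
points and depends sensitively on the initial state. -/
structure IsDevaneyChaotic (f : E → E) (Λ : Set E) : Prop where
  nonempty : Λ.Nonempty
  invariant : ∀ x : ℝ → E, IsTrajectory f x → x 0 ∈ Λ → ∀ t : ℝ, 0 ≤ t → x t ∈ Λ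
  transitive : ∀ U V : Set E, IsOpen U → IsOpen V → (Λ ∩ U).Nonempty → (Λ ∩ V).Nonempty →
    ∃ x : ℝ → E, IsTrajectory f x ∧ x 0 ∈ Λ ∩ U ∧ ∃ t : ℝ, 0 < t ∧ x t ∈ Λ ∩ V
  dense_periodic : Λ ⊆ closure (periodicPointsIn f Λ)
  sensitive : ∃ δ : ℝ, 0 < δ ∧ ∀ p ∈ Λ, ∀ ε : ℝ, 0 < ε →
    ∃ x y : ℝ → E, IsTrajectory f x ∧ IsTrajectory f y ∧ x 0 = p ∧ y 0 ∈ Λ ∧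
      dist (y 0) p < ε ∧ ∃ t : ℝ, 0 ≤ t ∧ δ < dist (x t) (y t)

end AutonomousODE

/-!
The proof rests on explicit polynomial Lyapunov functions.

*Coordinates.* In the variables `x ∝ x₁`, `y ∝ x₂ - x₁`, `z ∝ (3/8) x₁² - x₃` a point is an
equilibrium iff `y`, `z` and a cubic in `x` vanish; the cubic is `x - x³` if the scaling puts the
nonzero equilibria at `x = ±1`. Each Lyapunov function `V` is a polynomial in `x, y, z`, of degree
`12` (or `8`, for small `ρ`) when `x, y, z` have the weights `1, 2, 2`, and it is invariant under the
symmetry `(x, y, z) ↦ (-x, -y, z)` of the system.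

*The inequality.* Along the field,
`V' ≤ -c (y² + z² + (x - x³)²) - (x² - z) Q`, where `Q ≥ 0` and `x² - z` is a positive multiple of
`u = x₃ - x₁² / 20` (in the scaled coordinates; the unscaled analogues are the cubic `2 q x - 3 x³`
with `q = ρ - 1` and the factor `13 x² - 10 z`). Since `u' = -(8/3) u + (13/15) x₁²`, the function `u` is bounded below by
`-C exp (-8 t / 3)` (`lorenz_lower_bound`), so that the last term does no harm on a bounded
trajectory. The inequality itself is a polynomial identity: what is left over on the right is a sum
of quadratic forms, with integer coefficients, in polynomials that vanish at all equilibria. These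
forms are seen to be positive by completing squares in exact integer arithmetic (`isPosForm`,
`quadForm_nonneg`).

*The parameter.* For `ρ ≥ 81/20` put `ω = √((ρ - 1) / 10)`, which lies in `[11/20, 1] ∪ [1, 21/20]`.
In the scaled coordinates the field is affine in `ω`. On each of the two intervals `V` is chosen
affine in `ω` too; its derivative is then quadratic in `ω`, and it suffices to certify its three
Bernstein coefficients (`exists_lyapunov_of_bernstein`). The scaling degenerates at `ρ = 1`, so for
`ρ ≤ 81/20` the unscaled coordinates are used, and a function `V` quadratic in `q` is certified by an
identity whose coefficients `61 - 20 q` and `q + 1` are nonnegative (`lyapunov_low`).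

*Conclusion.* Trajectories are bounded by a quadratic function that decreases outside a ball, which
gives global existence as well (`exists_trajectory_of_dissipative`). Barbalat's argument
(`tendsto_zero_of_deriv_le`) shows that `y`, `z` and the cubic in `x` tend to zero, and a
continuous function along which the cubic tends to zero settles at one of its roots
(`exists_tendsto_of_cubic`). A periodic trajectory that converges is constant, so the closure of the
periodic points consists of finitely many equilibria, which rules out sensitive dependence.
-/

/-! ### Integer quadratic forms -/

/-- The linear form with integer coefficients `v`, evaluated at the vector `x`. -/
def intDot : List ℤ → List ℝ → ℝ
  | a :: v, x :: xs => a * x + intDot v xs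
  | _, _ => 0

/-- The quadratic form `∑ i ≤ j, aᵢⱼ xᵢ xⱼ`; the list `R` holds the rows `[aᵢᵢ, aᵢ,ᵢ₊₁, …]` of its
coefficients, so that an off-diagonal entry is twice the entry of the symmetric Gram matrix. -/
def quadForm : List (List ℤ) → List ℝ → ℝ
  | (d :: v) :: R, x :: xs => d * x ^ 2 + x * intDot v xs + quadForm R xs
  | _, _ => 0

/-- The rows `R` have the lengths `n, n - 1, …, 1`. -/
def isTriangular : ℕ → List (List ℤ) → Bool
  | 0, R => R.isEmpty
  | _ + 1, [] => false
  | n + 1, r :: R => r.length == n + 1 && isTriangular n R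

/-- The coefficients of the form `4 d R - v²`: up to the square of a linear form and the factor
`4 d`, what is left of the form with first row `d :: v` and further rows `R` when the first variable
is eliminated. -/
def schurRows (d : ℤ) : List ℤ → List (List ℤ) → List (List ℤ)
  | v :: vs, (r :: rs) :: R =>
      ((4 * d * r - v * v) :: List.zipWith (fun a b => 4 * d * a - 2 * v * b) rs vs) ::
        schurRows d vs R
  | _, _ => []

/-- Positivity test by completing squares without division. -/
def isPosForm : ℕ → List (List ℤ) → Bool
  | 0, _ => true
  | n + 1, (d :: v) :: R => decide (0 < d) && isPosForm n (schurRows d v R)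
  | _ + 1, _ => false

lemma intDot_zipWith (d v : ℤ) (rs vs : List ℤ) (xs : List ℝ) (h : rs.length = vs.length) :
    intDot (List.zipWith (fun a b => 4 * d * a - 2 * v * b) rs vs) xs =
      4 * d * intDot rs xs - 2 * v * intDot vs xs := by
  induction rs generalizing vs xs with
  | nil =>
    cases vs with
    | nil => simp [intDot]
    | cons => simp at h
  | cons r rs ih =>
    cases vs with
    | nil => simp at h
    | cons w vs =>
      cases xs with
      | nil => simp [intDot]
      | cons x xs =>
        simp only [List.zipWith_cons_cons, intDot, ih vs xs (by simpa using h)]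
        push_cast
        ring

lemma isTriangular_schurRows (d : ℤ) (n : ℕ) (v : List ℤ) (R : List (List ℤ)) (hv : v.length = n)
    (hR : isTriangular n R) : isTriangular n (schurRows d v R) := by
  induction n generalizing v R with
  | zero =>
    cases v with
    | nil => simp [schurRows, isTriangular]
    | cons => simp at hv
  | succ n ih =>
    match v, R with
    | [], _ => simp at hv
    | _ :: _, [] => simp [isTriangular] at hR
    | _ :: _, [] :: _ => simp [isTriangular] at hR
    | w :: vs, (r :: rs) :: R =>
      simp only [isTriangular, List.length_cons, Bool.and_eq_true, beq_iff_eq,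
        add_left_inj] at hR hv
      simp only [schurRows, isTriangular, List.length_cons, List.length_zipWith, hR.1, hv,
        min_self, BEq.rfl, Bool.true_and]
      exact ih vs R hv hR.2

lemma quadForm_schurRows (d : ℤ) (n : ℕ) (v : List ℤ) (R : List (List ℤ)) (xs : List ℝ)
    (hv : v.length = n) (hx : xs.length = n) (hR : isTriangular n R) :
    quadForm (schurRows d v R) xs = 4 * d * quadForm R xs - intDot v xs ^ 2 := by
  induction n generalizing v R xs with
  | zero =>
    obtain rfl := List.length_eq_zero_iff.mp hv
    obtain rfl := List.length_eq_zero_iff.mp hx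
    simp [schurRows, quadForm, intDot]
  | succ n ih =>
    match v, R, xs with
    | [], _, _ => simp at hv
    | _, _, [] => simp at hx
    | _ :: _, [], _ => simp [isTriangular] at hR
    | _ :: _, [] :: _, _ => simp [isTriangular] at hR
    | w :: vs, (r :: rs) :: R, x :: xs =>
      simp only [isTriangular, List.length_cons, Bool.and_eq_true, beq_iff_eq,
        add_left_inj] at hR hv hx
      simp only [schurRows, quadForm, intDot, ih vs R xs hv hx hR.2,
        intDot_zipWith d w rs vs xs (hR.1.trans hv.symm)]
      push_cast
      ring

/-- Induction on the number of variables: `4 d` times the form is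
`(2 d x + v)² + (4 d R - v²)`. -/
theorem quadForm_nonneg (n : ℕ) (R : List (List ℤ)) (hR : isTriangular n R) (h : isPosForm n R)
    (xs : List ℝ) (hx : xs.length = n) : 0 ≤ quadForm R xs := by
  induction n generalizing R xs with
  | zero =>
    obtain rfl := List.length_eq_zero_iff.mp hx
    simp [quadForm]
  | succ n ih =>
    match R, xs with
    | _, [] => simp at hx
    | [], _ => simp [isTriangular] at hR
    | [] :: _, _ => simp [isTriangular] at hR
    | (d :: v) :: R, x :: xs =>
      simp only [isTriangular, isPosForm, List.length_cons, Bool.and_eq_true, beq_iff_eq,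
        add_left_inj, decide_eq_true_eq] at hR hx h
      have hd : (0 : ℝ) < d := by exact_mod_cast h.1
      have key := ih _ (isTriangular_schurRows d n v R hR.1 hR.2) h.2 xs hx
      rw [quadForm_schurRows d n v R xs hR.1 hx hR.2] at key
      have : 0 ≤ 4 * (d : ℝ) * quadForm ((d :: v) :: R) (x :: xs) := by
        simp only [quadForm]
        nlinarith [sq_nonneg (2 * d * x + intDot v xs)]
      exact nonneg_of_mul_nonneg_right this (by positivity)

/-! ### Integer polynomials in three variables along a curve -/

/-- The value at `(x, y, z)` of the polynomial `∑ c xⁱ yʲ zᵏ`, given by its terms `(c, i, j, k)`. -/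
def polyEval (p : List (ℤ × ℕ × ℕ × ℕ)) (x y z : ℝ) : ℝ :=
  (p.map fun m => (m.1 : ℝ) * x ^ m.2.1 * y ^ m.2.2.1 * z ^ m.2.2.2).sum

/-- The derivative at `(x, y, z)` of the polynomial `p` in the direction `(u, v, w)`. -/
def polyDeriv (p : List (ℤ × ℕ × ℕ × ℕ)) (x y z u v w : ℝ) : ℝ :=
  (p.map fun m => (m.1 : ℝ) * (m.2.1 * x ^ (m.2.1 - 1) * u * y ^ m.2.2.1 * z ^ m.2.2.2 +
    x ^ m.2.1 * (m.2.2.1 * y ^ (m.2.2.1 - 1) * v) * z ^ m.2.2.2 +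
    x ^ m.2.1 * y ^ m.2.2.1 * (m.2.2.2 * z ^ (m.2.2.2 - 1) * w))).sum

lemma polyDeriv_smul (p : List (ℤ × ℕ × ℕ × ℕ)) (x y z r u v w : ℝ) :
    polyDeriv p x y z (r * u) (r * v) (r * w) = r * polyDeriv p x y z u v w := by
  induction p with
  | nil => simp [polyDeriv]
  | cons m p ih =>
    simp only [polyDeriv, List.map_cons, List.sum_cons] at ih ⊢
    rw [ih]
    ring

lemma hasDerivWithinAt_polyEval (p : List (ℤ × ℕ × ℕ × ℕ)) {x y z : ℝ → ℝ} {u v w t : ℝ}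
    {s : Set ℝ} (hx : HasDerivWithinAt x u s t) (hy : HasDerivWithinAt y v s t)
    (hz : HasDerivWithinAt z w s t) :
    HasDerivWithinAt (fun τ => polyEval p (x τ) (y τ) (z τ))
      (polyDeriv p (x t) (y t) (z t) u v w) s t := by
  induction p with
  | nil => simpa [polyEval, polyDeriv] using hasDerivWithinAt_const t s (0 : ℝ)
  | cons m p ih =>
    simp only [polyEval, polyDeriv, List.map_cons, List.sum_cons] at ih ⊢
    refine HasDerivWithinAt.add ?_ ih
    have h := (((hx.pow m.2.1).mul (hy.pow m.2.2.1)).mul (hz.pow m.2.2.2)).const_mul (m.1 : ℝ)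
    refine (h.congr_deriv ?_).congr_of_eventuallyEq ?_ ?_
    · simp only [Pi.mul_apply, Pi.pow_apply]
      ring
    · refine Eventually.of_forall fun τ => ?_
      simp only [Pi.mul_apply, Pi.pow_apply]
      ring
    · simp only [Pi.mul_apply, Pi.pow_apply]
      ring

lemma continuous_polyEval (p : List (ℤ × ℕ × ℕ × ℕ)) :
    Continuous fun q : ℝ × ℝ × ℝ => polyEval p q.1 q.2.1 q.2.2 := by
  induction p with
  | nil => simpa [polyEval] using continuous_const
  | cons m p ih =>
    simp only [polyEval, List.map_cons, List.sum_cons] at ih ⊢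
    fun_prop

/-! ### Coordinates and coefficients of the Lyapunov functions -/

/-- The polynomials, odd under `(x, y, z) ↦ (-x, -y, z)` and zero at the equilibria `(0, 0, 0)` and
`(±1, 0, 0)`, in which the odd Gram forms are written. -/
def oddBasis (x y z : ℝ) : List ℝ :=
  [y, y * z, y * z ^ 2, y ^ 3, x * z, x * z ^ 2, x * y ^ 2, x ^ 2 * y, x ^ 2 * y * z, x - x ^ 3,
    x ^ 3 * z, x ^ 4 * y, x ^ 3 - x ^ 5]

/-- The polynomials, even under `(x, y, z) ↦ (-x, -y, z)` and zero at the equilibria, in which the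
even Gram forms are written. -/
def evenBasis (x y z : ℝ) : List ℝ :=
  [z, z ^ 2, z ^ 3, y ^ 2, y ^ 2 * z, x * y, x * y * z, x ^ 2 * z, x ^ 2 * z ^ 2, x ^ 2 * y ^ 2,
    x ^ 3 * y, x ^ 2 - x ^ 4, x ^ 4 * z, x ^ 4 - x ^ 6]

/-- The odd polynomials, zero at the equilibria, for the form that multiplies `x² - z`. -/
def mulBasis (x y z : ℝ) : List ℝ :=
  [y, y * z, x * z, x * z ^ 2, x * y ^ 2, x ^ 2 * y, x - x ^ 3, x ^ 3 * z, x ^ 3 - x ^ 5]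

/-- The analogue of `oddBasis` in the unscaled coordinates, where the equilibria are the zeros of
`y`, `z` and `2 q x - 3 x³`. -/
def lowOddBasis (q x y z : ℝ) : List ℝ :=
  [y, y * z, x * z, x ^ 2 * y, 2 * q * x - 3 * x ^ 3]

/-- The analogue of `evenBasis` in the unscaled coordinates. -/
def lowEvenBasis (q x y z : ℝ) : List ℝ :=
  [z, z ^ 2, y ^ 2, x * y, x ^ 2 * z, 2 * q * x ^ 2 - 3 * x ^ 4]

/-- The analogue of `mulBasis` in the unscaled coordinates, for the form that multiplies
`13 x² - 10 z`. -/
def lowMulBasis (q x y z : ℝ) : List ℝ :=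
  [y, x * z, 2 * q * x - 3 * x ^ 3]

/-- Six times the derivative of `p` along the Lorenz field with `ρ = 1 + 10 ω²`, in the coordinates
`x = x₁ / (r ω)`, `y = (x₂ - x₁) / (r ω²)`, `z = (9 x₁² - 24 x₃) / (208 ω²)` with `r² = 80 / 3`; the
factor clears denominators. The nonzero equilibria are `x = ±1`, `y = z = 0`. -/
def scaledLie (p : List (ℤ × ℕ × ℕ × ℕ)) (ω x y z : ℝ) : ℝ :=
  polyDeriv p x y z (60 * ω * y) (-66 * y + ω * (60 * (x - x ^ 3) + 52 * x * z))
    (-16 * z + 120 * ω * x * y)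

/-- Six times the derivative of `p` along the Lorenz field with `ρ = 1 + q`, in the coordinates
`x = x₁ / 2`, `y = (x₂ - x₁) / 2`, `z = (3/8) x₁² - x₃`. -/
def lowLie (p : List (ℤ × ℕ × ℕ × ℕ)) (q x y z : ℝ) : ℝ :=
  polyDeriv p x y z (60 * y) (-66 * y + 6 * q * x - 9 * x ^ 3 + 6 * x * z) (-16 * z + 156 * x * y)

/-- The rescaled field is affine in `ω`. -/
lemma scaledLie_combo (p : List (ℤ × ℕ × ℕ × ℕ)) (s ω₁ ω₂ x y z : ℝ) :
    scaledLie p ((1 - s) * ω₁ + s * ω₂) x y z =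
      (1 - s) * scaledLie p ω₁ x y z + s * scaledLie p ω₂ x y z := by
  induction p with
  | nil => simp [scaledLie, polyDeriv]
  | cons m p ih =>
    simp only [scaledLie, polyDeriv, List.map_cons, List.sum_cons] at ih ⊢
    rw [ih]
    ring

/-- The part of the Lyapunov function for `ρ ≤ 81/20` that is constant in `q`. -/
def lowLyap0 : List (ℤ × ℕ × ℕ × ℕ) :=
  [(476544875460, 0, 0, 2), (23864186736, 0, 0, 3), (438609600, 0, 0, 4), (292379052, 0, 2, 0),
  (702756061884, 0, 2, 1), (222643324800, 0, 2, 2), (439255065600, 0, 4, 0), (1859398567836, 1,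
  1, 1), (608463633168, 1, 1, 2), (1932643717668, 1, 3, 0), (269262837192, 2, 0, 2),
  (-24545102400, 2, 0, 3), (2275231752444, 2, 2, 0), (-666723657600, 2, 2, 1), (544876668, 3, 1,
  0), (-1796087389092, 3, 1, 1), (162185373, 4, 0, 0), (-940864843272, 4, 0, 1), (97897381920, 4,
  0, 2), (499258637280, 4, 2, 0), (1327555061340, 5, 1, 0), (728307216756, 6, 0, 0),
  (-134822535120, 6, 0, 1), (62539522812, 8, 0, 0)]

/-- The coefficient of `q` in the Lyapunov function for `ρ ≤ 81/20`. -/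
def lowLyap1 : List (ℤ × ℕ × ℕ × ℕ) :=
  [(-154461471408, 0, 0, 2), (-6870968724, 0, 0, 3), (-251347272, 0, 2, 0), (175867509000, 0, 2,
  1), (-363251112, 1, 1, 0), (498616322964, 1, 1, 1), (-216247164, 2, 0, 0), (627243228848, 2, 0,
  1), (-42966768144, 2, 0, 2), (-316460493024, 2, 2, 0), (-885036707560, 3, 1, 0),
  (-728330427693, 4, 0, 0), (158704900488, 4, 0, 1), (-119497256148, 6, 0, 0)]

/-- The coefficient of `q²` in the Lyapunov function for `ρ ≤ 81/20`. -/
def lowLyap2 : List (ℤ × ℕ × ℕ × ℕ) :=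
  [(30947916, 2, 0, 0), (-45882140272, 2, 0, 1), (63906569204, 4, 0, 0)]

/-- The form in `lowOddBasis` for the coefficient of `61 - 20 q` in `lowLie_lowLyap`. -/
def lowGram0Odd : List (List ℤ) :=
  [[999536160959, 53683296060, 904357132046, -32110470018, -8358796800],
   [86794874100, 566983273140, -71741298240, -3237926207],
   [6013702317630, -492251667561, -109123752420],
   [72671397723, 4651994160],
   [10897533359]]

/-- The form in `lowEvenBasis` for the coefficient of `61 - 20 q` in `lowLie_lowLyap`. -/
def lowGram0Even : List (List ℤ) :=
  [[403844061995519, 29505749241600, 1058104926180, 99889061044500, -71389038216420,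
   -14445078172020],
   [561420288000, 26950668300, 3656863841580, -2632146744960, -524474340675],
   [94285166400, 157879332000, -80493795360, -20008163079],
   [7278578126820, -8851141604340, -1792005751800],
   [3191366425095, 1286018376660],
   [142172344074]]

/-- The form in `lowMulBasis` for the coefficient of `61 - 20 q` in `lowLie_lowLyap`. -/
def lowGram0Mul : List (List ℤ) :=
  [[7446036553200, -7831391124240, -3238648631640],
   [9394678753920, 8693755061400],
   [2031456067902]]

/-- The form in `lowOddBasis` for the coefficient of `q + 1` in `lowLie_lowLyap`. -/
def lowGram1Odd : List (List ℤ) :=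
  [[1550630661119, 921607796400, -1435085763446, 829839660678, -732217887360],
   [1079979354540, -922301375040, -291317295420, -574493144140],
   [593588622210, -974839987980, 668451714300],
   [1453427954460, -563002687800],
   [217950667199]]

/-- The form in `lowEvenBasis` for the coefficient of `q + 1` in `lowLie_lowLyap`. -/
def lowGram1Even : List (List ℤ) :=
  [[69598562119679, 55828456853760, 2965655138400, -14983372944900, -127466698128660,
   -18701527732020],
   [11228405760000, 1194931493460, -5523197829120, -51385767417000, -7638532583700],
   [1885703328000, -396394502400, -2753384576580, -400163261580],
   [20411612901000, -3226283404920, -8889832707480],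
   [62193010775040, 22014127034460],
   [2843446881480]]

/-- The form in `lowMulBasis` for the coefficient of `q + 1` in `lowLie_lowLyap`. -/
def lowGram1Mul : List (List ℤ) :=
  [[777037144339080, -747218343225600, -339855130790640],
   [188019291826620, 174160196650980],
   [40629121358040]]

/-- The Lyapunov function at `ω = 11/20` of the family that is affine on `[11/20, 1]`. -/
def midLyap0 : List (ℤ × ℕ × ℕ × ℕ) :=
  [(680135311, 0, 0, 2), (2581520486, 0, 0, 3), (3955578836, 0, 0, 4), (2727955395, 0, 0, 5),
  (710232515, 0, 0, 6), (11539758493, 0, 2, 0), (-34039805931, 0, 2, 1), (-84710453482, 0, 2, 2),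
  (-32519948986, 0, 2, 3), (4406170260, 0, 2, 4), (5487459669, 0, 4, 0), (13999089681, 0, 4, 1),
  (9783981900, 0, 4, 2), (1283364000, 0, 6, 0), (-15155406699, 1, 1, 0), (11134966370, 1, 1, 1),
  (12661955331, 1, 1, 2), (45068628304, 1, 1, 3), (27451450950, 1, 1, 4), (2297086096, 1, 3, 0),
  (45747180435, 1, 3, 1), (48374896120, 1, 3, 2), (12588464110, 1, 5, 0), (3646936709, 2, 0, 0),
  (61116061738, 2, 0, 1), (15895507620, 2, 0, 2), (-22455824250, 2, 0, 3), (-21227886369, 2, 0,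
  4), (-8080075982, 2, 0, 5), (50495585304, 2, 2, 0), (157171090675, 2, 2, 1), (86023937547, 2,
  2, 2), (-34583583000, 2, 2, 3), (19517896074, 2, 4, 0), (-22904710200, 2, 4, 1), (-42497633083,
  3, 1, 0), (-174784377756, 3, 1, 1), (-227399132914, 3, 1, 2), (-130727834613, 3, 1, 3),
  (-59879105825, 3, 3, 0), (-115272986648, 3, 3, 1), (-38313604102, 4, 0, 0), (-1745480000, 4, 0,
  1), (119508316063, 4, 0, 2), (102489920667, 4, 0, 3), (37389494385, 4, 0, 4), (-87518935442, 4,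
  2, 0), (-65511625514, 4, 2, 1), (81510105240, 4, 2, 2), (13377401100, 4, 4, 0), (159132312951,
  5, 1, 0), (340041341541, 5, 1, 1), (233586946179, 5, 1, 2), (68617664824, 5, 3, 0),
  (-19170133406, 6, 0, 0), (-186068933770, 6, 0, 1), (-211523835895, 6, 0, 2), (-84927883916, 6,
  0, 3), (15521732046, 6, 2, 0), (-77339042040, 6, 2, 1), (-157729318502, 7, 1, 0),
  (-186504884728, 7, 1, 1), (85352007476, 8, 0, 0), (187008986366, 8, 0, 1), (100830231689, 8, 0,
  2), (26023461060, 8, 2, 0), (56250045333, 9, 1, 0), (-59450290717, 10, 0, 0), (-60310634334,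
  10, 0, 1), (14389015899, 12, 0, 0)]

/-- The Lyapunov function at `ω = 1` of the family that is affine on `[11/20, 1]`. -/
def midLyap1 : List (ℤ × ℕ × ℕ × ℕ) :=
  [(4888901011, 0, 0, 2), (18366651626, 0, 0, 3), (27513235748, 0, 0, 4), (18273368242, 0, 0, 5),
  (4480844180, 0, 0, 6), (40376273091, 0, 2, 0), (-141207609938, 0, 2, 1), (-145032437851, 0, 2,
  2), (103913897829, 0, 2, 3), (82607548050, 0, 2, 4), (5839435034, 0, 4, 0), (19833120218, 0, 4,
  1), (14479234200, 0, 4, 2), (1509030000, 0, 6, 0), (-38726301515, 1, 1, 0), (125708067782, 1,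
  1, 1), (608473778555, 1, 1, 2), (740173100096, 1, 1, 3), (263099063850, 1, 1, 4), (23818343540,
  1, 3, 0), (89337015984, 1, 3, 1), (69693820264, 1, 3, 2), (8666082721, 1, 5, 0), (8605490230,
  2, 0, 0), (-14860446940, 2, 0, 1), (-298418435513, 2, 0, 2), (-502771626808, 2, 0, 3),
  (-358951199545, 2, 0, 4), (-98478273390, 2, 0, 5), (195342184516, 2, 2, 0), (403255494220, 2,
  2, 1), (-251954464618, 2, 2, 2), (-355527531480, 2, 2, 3), (-5057289403, 2, 4, 0),
  (-32881946400, 2, 4, 1), (-229768700112, 3, 1, 0), (-1502901185904, 3, 1, 1), (-2417003653367,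
  3, 1, 2), (-1115404502421, 3, 1, 3), (-92761732836, 3, 3, 0), (-149369069047, 3, 3, 1),
  (49971562925, 4, 0, 0), (656618148558, 4, 0, 1), (1522904198578, 4, 0, 2), (1348873502211, 4,
  0, 3), (441561387808, 4, 0, 4), (-265270412754, 4, 2, 0), (203784302161, 4, 2, 1),
  (576268218300, 4, 2, 2), (18704518200, 4, 4, 0), (897316366912, 5, 1, 0), (2636908499867, 5, 1,
  1), (1771319529066, 5, 1, 2), (80876207211, 5, 3, 0), (-377742198063, 6, 0, 0),
  (-1646876403566, 6, 0, 1), (-2083111988811, 6, 0, 2), (-873735179524, 6, 0, 3), (-54056993827,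
  6, 2, 0), (-416907164760, 6, 2, 1), (-959863187835, 7, 1, 0), (-1250019850547, 7, 1, 1),
  (599465988533, 8, 0, 0), (1464066500250, 8, 0, 1), (889698324916, 8, 0, 2), (113579050290, 8,
  2, 0), (331041822550, 9, 1, 0), (-389142564923, 10, 0, 0), (-458947798302, 10, 0, 1),
  (95421141432, 12, 0, 0)]

/-- The form in `oddBasis` for the Bernstein coefficient of `(1 - s)²`,
`ω ∈ [11/20, 1]`. -/
def midGram0Odd : List (List ℤ) :=
  [[10116882710714, 6309957614255, -7650980990885, -3986114311180, -15260716101538,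
   -6736174303314, -35050824825355, 1506001511445, 27700741897011, -10012893627330,
   15804278739077, -19724696806100, 9306391438170],
   [1201956370495, -2406916252520, -1384163561995, -4718394034935, -2116471231553,
   -11521021115118, 13320734720, 8594441559280, -3020781876230, 4921467582579, -6088755493740,
   2867714458069],
   [2023903617085, 1809238353110, 7185872254830, 4191121433371, 18396126012463, -3695808970590,
   -16085774343005, 3871892220000, -9112650263867, 11824344103022, -5063977302209],
   [463964141850, 3291459171090, 1695620772770, 8439830122350, -897191995240, -6823568390745,
   1948557799510, -3810620760158, 4929062867055, -2170260640205],
   [6749264495740, 7316113870477, 32594097824385, -5308293966940, -28044688524635, 7729016792117,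
   -16165929685786, 20493976222125, -9102838755909],
   [2390350041940, 18913195717425, -5203557070410, -17442459235365, 3508513643025,
   -10082170928720, 13006530191990, -5462394801446],
   [42166947501230, -15978334490110, -72832517704730, 17603101390105, -41163783814235,
   53471341977005, -22883206917810],
   [4799960437195, 17794617830100, -1173735892515, 10152037905215, -13809428025650,
   5135405515580],
   [32790525286350, -14227077551730, 37304281870125, -48595353667356, 20457292649616],
   [2500642105334, -8157491392745, 10184272379365, -4775964262080],
   [10756530655460, -27678661727380, 11772118543668],
   [18048960383965, -15116561811060],
   [3248046358025]]

/-- The form in `evenBasis` for the Bernstein coefficient of `(1 - s)²`,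
`ω ∈ [11/20, 1]`. -/
def midGram0Even : List (List ℤ) :=
  [[108821649759, 619564916640, 369158467020, -1968088679625, -1395297825995, -2814648475660,
   -2005613679015, 2650017713530, 459390544950, 1180582627295, 1703510814115, 1989180381335,
   -1905912484500, -1076951768330],
   [896626760500, 1091182158000, -5403606448465, -3878811974065, -7871267206170, -5571773339910,
   7260258800935, 1154754107308, 3294416945245, 4827170571905, 5496476724065, -5253261018135,
   -3005690711135],
   [340911607200, -3039444620480, -2235346169035, -4576944635320, -3220631333125, 4092534497420,
   565638106505, 1908031201805, 2866251894465, 3136209261450, -2989931091531, -1741168946493],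
   [10850541868420, 13434604343620, 26324251686255, 17838507726870, -26764211342655,
   -5357067814725, -11348027739235, -14507053983755, -19827744738950, 18703580836770,
   10304642052045],
   [4689196999090, 18742241530950, 13518318011030, -18233755507250, -3560079374190,
   -7888023039620, -11135093952965, -13491526467905, 12998510135560, 7202155349155],
   [18901865219885, 27409312071985, -36367755299160, -6996676413250, -15777649404600,
   -22770783646120, -26929454589665, 26064578091200, 14488406458080],
   [10302175045520, -26160474900865, -5230461679310, -11322813774250, -16969093492385,
   -19231507790990, 18881268036720, 10430182604335],
   [18062716226185, 7480869964025, 15308844247480, 21240757762060, 26527738059565,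
   -25621199572830, -14047177708825],
   [967347392615, 2943467252370, 3927816913730, 5303917184075, -5229035624765, -2730338019779],
   [3322043853010, 9371038335400, 11350342000935, -10919167300460, -6066578933495],
   [7151132868810, 15756940995370, -15448677780105, -8652872851585],
   [9789757298605, -18832035746650, -10390601721075],
   [9134808889105, 10049851288374],
   [2788644552915]]

/-- The form in `mulBasis` for the Bernstein coefficient of `(1 - s)²`,
`ω ∈ [11/20, 1]`. -/
def midGram0Mul : List (List ℤ) :=
  [[31368594774620, 58303865590005, -40479632857755, -28362325330015, -12262509006900,
   -66672441814130, -12977058014560, 52904851936530, 24580984699275],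
   [27379104910495, -39553940555430, -27223698341470, -11363008495835, -62059180120085,
   -13072893607455, 50648793206560, 23465184783100],
   [22981943301125, 25404865538970, 8342738431490, 46411254205145, 19542514177685,
   -49705765289350, -23872436539125],
   [7723225985155, 5665869740655, 31267439444265, 9826410279180, -29487565673370,
   -13916972431360],
   [1223057736725, 13223895600070, 2780945429220, -10724580299430, -5040983710755],
   [35920742205865, 15693028485710, -59061777513045, -27707523904895],
   [4498958527505, -19680556492195, -9601524709835],
   [28463313371580, 27099448994055],
   [6492612927030]]

/-- The form in `oddBasis` for the Bernstein coefficient of `s (1 - s)`,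
`ω ∈ [11/20, 1]`. -/
def midGram1Odd : List (List ℤ) :=
  [[45201042605114, 30238446215115, -33132708057635, -407175696425, -97518644259446,
   -51747706546337, -65912369616350, -12647842697170, 97747540869635, -43056962727750,
   103385736901045, -63315317224200, 50413732546170],
   [31797250264460, 35503653875020, 2027778167965, -15495893306265, 7652876753451,
   -21282037332243, -45452840890695, -55572625599446, -22607711502875, -4734154778896,
   18597020545744, 2845177671869],
   [26690035365515, 2625354430665, 50845428534850, 40957494682846, 31383365490534,
   -33390752127130, -117419166300066, 8893885544200, -73616527985007, 61886263688343,
   -31964074505089],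
   [322497238035, 1297529868885, 1461836644555, 6279791749200, -3547998067765, -8274436810270,
   97899900055, -3378837061709, 5550853869940, -1940287510350],
   [55371846994320, 63898810571270, 73164977427715, -137022428085, -135024760358255,
   43890700584420, -124552575256148, 82161964010280, -59238756790944],
   [20692045616070, 40470329693615, -12763573642140, -98883042820660, 20909512204900,
   -78106680176887, 56284904516960, -35882466741655],
   [57110073707085, -12754696237185, -119854445757665, 33920263139100, -90645316761425,
   87343169152740, -49741518518065],
   [20242082447435, 69656784509255, 11493663769405, 20566679979685, -34927903657790,
   7865936796150],
   [142628470351330, -34901797214760, 187239530491365, -163174761897529, 86811020099043],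
   [10936461759674, -43792887350890, 25675675036870, -22370297236810],
   [75248079287710, -110699570807320, 70846346273905],
   [49432804016440, -53592574808220],
   [17141478766485]]

/-- The form in `evenBasis` for the Bernstein coefficient of `s (1 - s)`,
`ω ∈ [11/20, 1]`. -/
def midGram1Even : List (List ℤ) :=
  [[891045811519, 5027561306880, 2970639974240, 5675947200185, 3923614809920, 16884458387705,
   15116870137850, -27544329125711, -16134659745185, -4390957991970, -13360616262470,
   -12094671681810, 22446600445670, 9250123576535],
   [7099380692640, 8400529454800, 16189032029115, 11275298857670, 47676126478310, 42887282841950,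
   -77953890667350, -45723474848853, -12564619115990, -37869516265570, -34189437058680,
   63636101889740, 26222451773365],
   [2491716813600, 9772816673365, 6936627758035, 28140799191295, 25623220275475, -46301190054140,
   -27251665771605, -7651118814100, -22569152525420, -20239831680985, 37954736366443,
   15634461016238],
   [10739524191485, 16872553922775, 53491889096155, 52632114618660, -91697750381575,
   -55129497475975, -17627559782825, -45664504874165, -39258193464090, 77165783826980,
   31729550025550],
   [7272256217775, 36537193003550, 39316147169935, -65714551335640, -40468121351895,
   -14547124672580, -33557472831050, -27431587045585, 56916700672070, 23347769299045],
   [80520175451350, 143001280445300, -261322339359760, -152652695314290, -41161106044125,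
   -126637248115910, -115081970913595, 212428569677050, 87601094640445],
   [67326102615920, -239224858442395, -142087301453225, -42262109039845, -117827870915925,
   -103643364035370, 198352452750935, 81646307061505],
   [215470853252245, 253958381551010, 72135705810525, 210511242589260, 188159120686020,
   -353937358633360, -145803676528265],
   [75187601476800, 43867485813040, 124610342285355, 110362870027125, -209746191572505,
   -86355936088126],
   [7430280802680, 36379562500325, 30515602970820, -61547814056745, -25279101663745],
   [51679861365300, 91511961489545, -173854959480830, -71592358736895],
   [41268250484450, -153689897810110, -63348539307535],
   [146321250085315, 120482997715500],
   [24804516132240]]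

/-- The form in `mulBasis` for the Bernstein coefficient of `s (1 - s)`,
`ω ∈ [11/20, 1]`. -/
def midGram1Mul : List (List ℤ) :=
  [[189679802253390, 311363119999795, -379331094708450, -208376125302855, -6416393815650,
   -341048636467400, -173013121101630, 395632177312420, 187102211448405],
   [127946365454395, -314011639710535, -172419629229755, -3608763771470, -278754047100790,
   -143466241857100, 326595561279965, 154174197338885],
   [200411860422185, 219534065698575, -6949068453150, 331548225334430, 184819366487610,
   -410630716407440, -191941986213335],
   [60132217354745, -3413368855300, 182425740953330, 101166165035950, -225128588769605,
   -105298718667195],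
   [4205429802440, 11657176903255, -4414158844540, 2637689669160, -152625353320],
   [155407039183410, 150328673979455, -349093066763060, -166089218261115],
   [42699633955415, -188679876370560, -87992246681675],
   [211562567146400, 198534011876855],
   [46692398188410]]

/-- The form in `oddBasis` for the Bernstein coefficient of `s²`,
`ω ∈ [11/20, 1]`. -/
def midGram2Odd : List (List ℤ) :=
  [[38266230694559, 61671378825770, -362215769880, -349378141285, -88937186808865,
   -45236667691230, -33107951254555, -52792193302400, 24509395198470, -42168737492550,
   93351592793825, -22498756721615, 47511501691345],
   [24852444641445, -293711697280, -349664789335, -71651253852520, -36442110538645,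
   -26901310074870, -42530785898045, 19862155031195, -33983119269930, 75279400424700,
   -18242179345890, 38350267760380],
   [2775459735, 44068985050, 410398160850, 207230406285, 300351150545, 240418857890,
   -193234705690, 201055924345, -477146636140, 181176516070, -266495067445],
   [388054583700, 216088203490, 81290267295, 2717284000650, 98751853365, -1443293421665,
   221631752710, -1053117138310, 1415341148570, -959536520580],
   [51699931691650, 52600305795090, 37844843475185, 61384223550380, -28155489076320,
   48996505083285, -108329927912150, 25823629535725, -55030742118480],
   [13379764924505, 19154694821895, 31227756213600, -14272052253815, 24920277400000,
   -55078274072895, 13086581103695, -27963643038585],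
   [11417376338670, 22364128467030, -15024650964155, 18338549368830, -42465100378445,
   14089471078820, -23017672294875],
   [18223414958840, -16657307686830, 29082806610235, -64280261474435, 15275513076885,
   -32638039714505],
   [5075660675360, -13554230981890, 30977338557770, -9470701586525, 16495525113525],
   [11617890454499, -51459418301295, 12445811328705, -26206304483655],
   [57189710127960, -28508548863445, 58557340926475],
   [4422471067240, -15228332918035],
   [15104961086320]]

/-- The form in `evenBasis` for the Bernstein coefficient of `s²`,
`ω ∈ [11/20, 1]`. -/
def midGram2Even : List (List ℤ) :=
  [[782224161759, 4407996390240, 2594097305335, 1681855857980, 1219851097455, 15798752049440,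
   13029074169075, -25213708976095, -14693613961510, -1213788521070, -12232469759025,
   -11204361604415, 21075988833740, 8969870344180],
   [6210138134025, 7309347296800, 4739424048890, 3437282754475, 44515746720495, 36711644950505,
   -71044192182225, -41401959197030, -3420191669285, -34467009966920, -31570352245310,
   59385444599005, 25274230033405],
   [2150805206400, 2789485557320, 2022902474265, 26197301045105, 21604646077400, -41809541966860,
   -24365163134085, -2012829369745, -20283621793880, -18579129949170, 34948395497550,
   14873878065635],
   [911929324165, 1314928299335, 16978412818845, 13997555207590, -27108296045110,
   -15797263919485, -1307524323495, -13140468533240, -12047198477910, 22657087912470,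
   9642203725205],
   [477051551750, 12325927105115, 10164936720875, -19669973419375, -11461800233405,
   -948810203060, -9543146980240, -8741753225935, 16441988576530, 6997933061725],
   [79797878065170, 131619432542995, -254674775748025, -148408981978885, -12264120217145,
   -123573049928590, -113175518305835, 212882923084525, 90604529372485],
   [54275162540225, -210029357014010, -122393229318480, -10113999996805, -101914289252085,
   -93334595131910, 175565852847320, 74722252887810],
   [203210116852535, 236840743246020, 19570966989125, 197188110192070, 180607742031845,
   -339725929438385, -144588276479060],
   [69010019614475, 11404251827160, 114909969814780, 105247841640440, -197975487841460,
   -84258598992820],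
   [471926521555, 9495594852995, 8697660921995, -16359364866525, -6962812526015],
   [47842361144995, 87628148240340, -164832220344695, -70154222312760],
   [40130243796985, -150969060806310, -64253040221325],
   [141989131052465, 120862173419435],
   [25719799582425]]

/-- The form in `mulBasis` for the Bernstein coefficient of `s²`,
`ω ∈ [11/20, 1]`. -/
def midGram2Mul : List (List ℤ) :=
  [[205559286372470, 331918236622230, -478699959237010, -250863579248590, 1834781146205,
   -365676628618170, -225440352726255, 493781019560775, 241839803504875],
   [134462478597215, -392857593463035, -206153374318735, 4272548223235, -293982448513970,
   -185032745244135, 404308009773300, 197412028941995],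
   [300120040260695, 316407372794975, -20891806811375, 417399342275075, 282809328742145,
   -612923454818040, -296117433403695],
   [83431902822915, -11758205109820, 218377276844060, 149083632328510, -322844215948080,
   -155808489432700],
   [4108951047075, 2040681154895, -9896063656710, 18823810626240, 7435534468755],
   [163451365096175, 196545211359150, -431770845297455, -212267414359505],
   [66624561174770, -288767093694380, -139498330450495],
   [313358800081345, 303337732289250],
   [73592747182575]]

/-- The Lyapunov function at `ω = 1` of the family that is affine on `[1, 21/20]`. -/
def highLyap0 : List (ℤ × ℕ × ℕ × ℕ) :=
  [(373962505, 0, 0, 2), (1488092075, 0, 0, 3), (2441909953, 0, 0, 4), (1851500690, 0, 0, 5),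
  (535639742, 0, 0, 6), (1831786536, 0, 2, 0), (-61368274421, 0, 2, 1), (-70293155458, 0, 2, 2),
  (76473631164, 0, 2, 3), (66483573270, 0, 2, 4), (6203984876, 0, 4, 0), (19441592887, 0, 4, 1),
  (20799146700, 0, 4, 2), (1750572000, 0, 6, 0), (-1444672873, 1, 1, 0), (58154818305, 1, 1, 1),
  (259241803082, 1, 1, 2), (472164222186, 1, 1, 3), (222975253369, 1, 1, 4), (10357096026, 1, 3,
  0), (59108335757, 1, 3, 1), (87704323145, 1, 3, 2), (10928370487, 1, 5, 0), (167803250, 2, 0,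
  0), (-11853197730, 2, 0, 1), (-129803422028, 2, 0, 2), (-170096291055, 2, 0, 3),
  (-147202519872, 2, 0, 4), (-60832935286, 2, 0, 5), (60076386395, 2, 2, 0), (193697374681, 2, 2,
  1), (-132272530093, 2, 2, 2), (-301986147360, 2, 2, 3), (1623866226, 2, 4, 0), (-46149780600,
  2, 4, 1), (-73693176649, 3, 1, 0), (-624689429098, 3, 1, 1), (-1528525724706, 3, 1, 2),
  (-987099530474, 3, 1, 3), (-54330902411, 3, 3, 0), (-193339390579, 3, 3, 1), (18591489585, 4,
  0, 0), (282536702475, 4, 0, 1), (592670902993, 4, 0, 2), (641009866511, 4, 0, 3),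
  (316184788706, 4, 0, 4), (-140108083264, 4, 2, 0), (23076221779, 4, 2, 1), (513774844260, 4, 2,
  2), (25700748300, 4, 4, 0), (361155026244, 5, 1, 0), (1674803544302, 5, 1, 1), (1636670344874,
  5, 1, 2), (107126997276, 5, 3, 0), (-150621601226, 6, 0, 0), (-680479705252, 6, 0, 1),
  (-1067993263976, 6, 0, 2), (-670665611292, 6, 0, 3), (34360385866, 6, 2, 0), (-388132404480, 6,
  2, 1), (-618818329494, 7, 1, 0), (-1205300495671, 7, 1, 1), (255876323380, 8, 0, 0),
  (792684459985, 8, 0, 1), (715538273838, 8, 0, 2), (109883475270, 8, 2, 0), (332801152772, 9, 1,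
  0), (-220352601402, 10, 0, 0), (-382888259478, 10, 0, 1), (82128622458, 12, 0, 0)]

/-- The Lyapunov function at `ω = 21/20` of the family that is affine on `[1, 21/20]`. -/
def highLyap1 : List (ℤ × ℕ × ℕ × ℕ) :=
  [(992942736, 0, 0, 2), (3825183335, 0, 0, 3), (6162517545, 0, 0, 4), (4664076761, 0, 0, 5),
  (1366782572, 0, 0, 6), (9932059471, 0, 2, 0), (-41519169605, 0, 2, 1), (-38935734175, 0, 2, 2),
  (105715975228, 0, 2, 3), (77531072010, 0, 2, 4), (16506798101, 0, 4, 0), (27212451268, 0, 4,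
  1), (25141601700, 0, 4, 2), (1970757000, 0, 6, 0), (-10239336215, 1, 1, 0), (46623212307, 1, 1,
  1), (298425312538, 1, 1, 2), (538096526145, 1, 1, 3), (252313163450, 1, 1, 4), (47094602959, 1,
  3, 0), (85052771271, 1, 3, 1), (103198953112, 1, 3, 2), (12352474412, 1, 5, 0), (2534789895, 2,
  0, 0), (-9383974424, 2, 0, 1), (-122426022915, 2, 0, 2), (-183597747191, 2, 0, 3),
  (-177572093937, 2, 0, 4), (-75394291174, 2, 0, 5), (43235074592, 2, 2, 0), (113046488928, 2, 2,
  1), (-220195658710, 2, 2, 2), (-353703064320, 2, 2, 3), (-1411802487, 2, 4, 0), (-55407171600,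
  2, 4, 1), (-113712368762, 3, 1, 0), (-772086933126, 3, 1, 1), (-1770789016374, 3, 1, 2),
  (-1128528896072, 3, 1, 3), (-72791053609, 3, 3, 0), (-226109710565, 3, 3, 1), (36449941537, 4,
  0, 0), (315069392744, 4, 0, 1), (649814708342, 4, 0, 2), (748108376911, 4, 0, 3),
  (380522591812, 4, 0, 4), (-92653058182, 4, 2, 0), (102879623530, 4, 2, 1), (603715746900, 4, 2,
  2), (30659721300, 4, 4, 0), (461077115962, 5, 1, 0), (1958653806430, 5, 1, 1), (1887863786416,
  5, 1, 2), (124608357499, 5, 3, 0), (-188585618236, 6, 0, 0), (-765952163398, 6, 0, 1),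
  (-1235638211987, 6, 0, 2), (-799671248516, 6, 0, 3), (13584457946, 6, 2, 0), (-457129784640, 6,
  2, 1), (-726442588859, 7, 1, 0), (-1400906358716, 7, 1, 1), (293746348663, 8, 0, 0),
  (914049699100, 8, 0, 1), (849727159784, 8, 0, 2), (129612306810, 8, 2, 0), (389317177874, 9, 1,
  0), (-253611694749, 10, 0, 0), (-453782954022, 10, 0, 1), (97232543472, 12, 0, 0)]

/-- The form in `oddBasis` for the Bernstein coefficient of `(1 - s)²`,
`ω ∈ [1, 21/20]`. -/
def highGram0Odd : List (List ℤ) :=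
  [[1642380975659, 1656920012480, -983560767545, -914062403425, -4760659225345, -3070457246045,
   -5839077322610, -1346679442570, 5611730975385, -1676495919690, 7547288948795, -4426244857110,
   4392767707805],
   [602789832265, -193564936135, -264018054240, -2284198623845, -1329009643335, -1909794064260,
   -599890242035, 1721313407270, -906974202300, 2896177876240, -1470983278565, 1537059928745],
   [274322499045, 439794716170, 1529378109460, 1112219438490, 2633784830100, 491411936580,
   -2615270513830, 450822070125, -3052086138975, 1968709175360, -1904621006680],
   [187621413900, 1399704818985, 992114670505, 2241506235750, 448339236815, -2193546893050,
   431404738885, -2658402255970, 1671370824500, -1636206386555],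
   [3482028132655, 4560376109865, 8869355860070, 2049928055860, -8535412602400, 2406349740115,
   -11360616136070, 6695697334580, -6674251164970],
   [1531760863310, 6201266267900, 1426177847630, -5985221104790, 1524227129210, -7807686049930,
   4652098106945, -4657937245555],
   [6832134055970, 2829230511040, -13326665954895, 2795875092325, -16421902880865,
   10197118729590, -10036191941920],
   [447596375240, -2652339689690, 660729506870, -3732945910600, 2058902021970, -2268415316160],
   [6540164898085, -2672551366930, 15902900007935, -9978110651110, 9736936688220],
   [433401861899, -3679218552575, 2126961022785, -2114196584580],
   [10162692132330, -12258662671700, 12292771039770],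
   [3819597136200, -7467775116580],
   [3749380108035]]

/-- The form in `evenBasis` for the Bernstein coefficient of `(1 - s)²`,
`ω ∈ [1, 21/20]`. -/
def highGram0Even : List (List ℤ) :=
  [[59834000799, 357142098000, 247791324105, -1162483348420, -972292023210, -997134515085,
   -184119504040, 529756199380, -554664096115, 801228999465, -187871008100, 863528064465,
   523423601895, 223310837150],
   [533619860855, 740600276000, -3473280964345, -2904700707375, -2949024337870, -541142257540,
   1566728624530, -1654271038805, 2395154426455, -560860606095, 2562807623880, 1553641822805,
   659988013495],
   [257107076160, -2402353454270, -2012996705145, -2060111007390, -379803924155, 1090245559260,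
   -1151554550960, 1658834133540, -388205470790, 1783762568565, 1085791071755, 462394616170],
   [5996193631945, 9749747368940, 8991548613865, 1508573900185, -5129585693755, 5189053640875,
   -8096714889265, 1946258599760, -8222520091385, -4638914381505, -1914639389210],
   [4031645456330, 7845038206335, 1413627536810, -4344103069020, 4401095151705, -6675370095715,
   1532141811375, -6971073293685, -4012026542895, -1677306332895],
   [5179915812930, 2227888574235, -5212370236710, 4927401734320, -6334351479745, 1436130999635,
   -8153527474275, -5204806126640, -2404835882655],
   [293637531700, -1108526347850, 910897470250, -1130663787555, 149646126005, -1637040712610,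
   -987510454240, -470074236190],
   [1418408969590, -2472396388210, 3548181389615, -748839957710, 4282308578535, 2451399617760,
   1103271126290],
   [1347985879535, -3591150502120, 925567265350, -4112737321270, -2712482558565, -1201513338805],
   [2771917358165, -1244250476775, 5689788561320, 3211790679265, 1322534822155],
   [240762594580, -1321824963005, -958745803435, -432534418745],
   [3366587273680, 4116445103735, 1841542700940],
   [1493444474205, 1395618976120],
   [336459549595]]

/-- The form in `mulBasis` for the Bernstein coefficient of `(1 - s)²`,
`ω ∈ [1, 21/20]`. -/
def highGram0Mul : List (List ℤ) :=
  [[63353405227100, 130586584477325, -208954574356285, -142649843509080, 7246297595695,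
   -192702033413005, -73039842733660, 300721269516265, 158188319354580],
   [67322379510420, -215750100821305, -147312076861435, 7646806102545, -198653162128220,
   -75401770251090, 310453552018245, 163268655540285],
   [174157862499835, 237727815521865, -14352409122980, 316442250038675, 121760160293505,
   -499288792358565, -261825867425980],
   [81155185439380, -9607405892485, 216434697603835, 83073586017330, -341128623929190,
   -178995796854170],
   [1187393737235, -9120033451130, -5092069602150, 18490665818425, 8942486169245],
   [148084312329550, 110428623968915, -458355943393345, -242057345452035],
   [21288964167500, -174375883015115, -91396075825575],
   [359324597561425, 377850003922135],
   [99503886282005]]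

/-- The form in `oddBasis` for the Bernstein coefficient of `s (1 - s)`,
`ω ∈ [1, 21/20]`. -/
def highGram1Odd : List (List ℤ) :=
  [[11291011184114, 16683246272925, -3535171079550, -1293997982760, -34108907997451,
   -21386628122434, -12815647171925, -17494966733630, 16674061926386, -12595574183820,
   45119409327683, -12349429055435, 23482086468205],
   [6273058498135, -2245526547940, -781240336945, -24852435596505, -15329619386302,
   -7897015127927, -12208640406365, 10931729417807, -9333220368585, 31425481048725,
   -8108291055906, 15931318932637],
   [605772759095, 511587823695, 5985973243645, 4236996878101, 4925520514516, 4204687277375,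
   -5121033825535, 1920240442505, -10679081135837, 3776003664291, -6365891411071],
   [220052392995, 2189389502460, 1556463500015, 2805821893560, 1544657426600, -2505387947635,
   728329420095, -4344371064707, 1950704856260, -2751384859150],
   [26119673099950, 33257363959879, 21921788289505, 27938233087775, -27503253297275,
   18975055399899, -71765690298689, 20312906826725, -38095486171689],
   [10777583131770, 15738752087175, 18707312415455, -18998548195955, 11841556614665,
   -47726252699584, 13997407012835, -25886225822102],
   [11912222099565, 16725913690680, -22303017794430, 7090538971495, -42611841434575,
   16911749241950, -26539985003740],
   [8875933519415, -18492218552955, 9628487866130, -43820384429620, 13654237037550,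
   -24832511588265],
   [11363892147815, -9191392162420, 47459105941805, -16998381096769, 28121743292326],
   [3526872819494, -24920231004635, 6833289591770, -12940783489220],
   [55484251467620, -35154387636080, 62529374561034],
   [6387931693625, -20903449466455],
   [18110197155830]]

/-- The form in `evenBasis` for the Bernstein coefficient of `s (1 - s)`,
`ω ∈ [1, 21/20]`. -/
def highGram1Even : List (List ℤ) :=
  [[218704838559, 1275186098400, 885967344990, -3301516088725, -2727064854330, -5859703967890,
   -1645308879585, 2880642396675, -2029011180205, 2486641308695, 610981755345, 4109152620250,
   1705289479190, 587225961805],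
   [1867449454370, 2606230980400, -9461197338400, -7864891738230, -17392660966785,
   -4914250168130, 8467863093195, -5997747397533, 7153788128030, 1824505360215, 12084358425305,
   5111722955385, 1794953904360],
   [913162710720, -6457838147815, -5402574230930, -12296484687980, -3495060201210, 5929902147360,
   -4223025184852, 4901813736670, 1297287356825, 8466165287940, 3648082223822, 1304641597782],
   [13881365376510, 21961945009190, 41123667546200, 10818723627145, -21403219084090,
   14553078635650, -20333113788725, -3909463013295, -30400955817430, -11431072831690,
   -3502835546255],
   [8894172084030, 34934838339055, 9610961485400, -17814770137870, 12182051180885,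
   -16386884671955, -3617700561195, -25265982175520, -9750345808895, -3115310983725],
   [42363900104455, 24540131442425, -40221737198175, 28605283165445, -31503291736505,
   -9163257518495, -57188504640455, -25344505652990, -9409761898445],
   [3766251871570, -11488590255320, 8051602560245, -8600713905580, -2987969586410,
   -16177441301285, -7183008802740, -2736409762030],
   [9895688121920, -13540256621390, 16093791995040, 4218280113015, 27837432154370,
   11573483122340, 4137227430340],
   [4958044176390, -11073435133125, -2958974909425, -19516645910150, -8752602020360,
   -3184549881343],
   [7613465394125, 3341743673105, 22918894075410, 8756572256445, 2713762300935],
   [703432960505, 5945158559585, 2540592142690, 919257295280],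
   [19762427441335, 16801441468040, 5998373906580],
   [4061394662860, 3132469902991],
   [648382251550]]

/-- The form in `mulBasis` for the Bernstein coefficient of `s (1 - s)`,
`ω ∈ [1, 21/20]`. -/
def highGram1Mul : List (List ℤ) :=
  [[121824170221615, 251306076457145, -438919710390010, -293359164163215, 21451704408375,
   -375482413680715, -161104688344300, 620097335445350, 327669117050055],
   [129621785645305, -452438171754860, -302521716580315, 21837022563475, -387797450391320,
   -165971089460490, 639746165021845, 338178131589250],
   [397001201289895, 529374697601190, -41715597707220, 671229970120870, 292470004056790,
   -1116020386776040, -588406626694275],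
   [176741532065885, -26627686305715, 450787062526260, 194572030383310, -746425541944020,
   -394085949571465],
   [2404630202210, -28068523932905, -16290767626275, 53457312790535, 26988939911060],
   [293636681773505, 244686973048720, -957728558351525, -508243350711835],
   [54032290140415, -409240267638105, -215341605025340],
   [789462720759965, 834840837648340],
   [220979134233830]]

/-- The form in `oddBasis` for the Bernstein coefficient of `s²`,
`ω ∈ [1, 21/20]`. -/
def highGram2Odd : List (List ℤ) :=
  [[9780550158584, 19222738418170, 400810305450, -602662036480, -28053156806786, -17722901940920,
   -12640071773530, -28202716303695, 6257087755484, -11233096051530, 43327770761234,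
   -6365943466605, 25460166966610],
   [9449111640825, 400855584410, -589752378175, -27568082847160, -17415879013410,
   -12403658438907, -27727090058555, 6125712615326, -11039268562445, 42574118838372,
   -6239806331289, 25016129311259],
   [7596111280, -9604356280, -573710768580, -360913337598, -239279545361, -585438062985,
   104640307942, -230670123070, 877677130940, -113953458420, 513879780385],
   [11069420220, 864386570310, 546661469575, 402443317770, 864007107740, -205063584725,
   345964400850, -1339439015661, 205700582670, -788294396585],
   [20117248860525, 25420382641411, 18131283926395, 40453028055045, -8976778969650,
   16109553354950, -62148721059899, 9131790143610, -36520784597459],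
   [8031118447280, 11460164104480, 25560989607010, -5676256317260, 10177206792555,
   -39272395856351, 5772656658165, -23079025690133],
   [4120229505275, 18206862450485, -4118033156550, 7257466779590, -28037138477195, 4168510102260,
   -16483237364640],
   [20354698065910, -8991977237730, 16195946577225, -62498341925730, 9157093056920,
   -36728721543025],
   [1043119277475, -3591587690310, 13893860654945, -2097052264126, 8171049384876],
   [3225390907724, -24880330950820, 3654628533105, -14620034360965],
   [48016154400125, -14125131259035, 56439176631965],
   [1057864521090, -8305194255515],
   [16585828475385]]

/-- The form in `evenBasis` for the Bernstein coefficient of `s²`,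
`ω ∈ [1, 21/20]`. -/
def highGram2Even : List (List ℤ) :=
  [[158870837759, 918044000400, 645607962195, -2183565738855, -1725445869905, -5385523354160,
   -1703660952760, 3049961121604, -1214171886625, 1609062838610, 981129735075, 3666221942375,
   700928309945, 152326907730],
   [1326397652205, 1865630704400, -6306847283710, -4984733892775, -15561284604690,
   -4923133727475, 8811279952845, -3509094792625, 4648505267735, 2835432357805, 10592555463990,
   2026399580990, 440613056010],
   [656055634560, -4434454545610, -3505792028230, -10945902120565, -3464011406455, 6198000678875,
   -2467803140420, 3268872539215, 1994133148955, 7450403778225, 1425790603766, 310652309468],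
   [7556835597715, 11895561203010, 37038178553020, 11685664654880, -21030946449890,
   8326342966700, -11098663334980, -6734027725050, -25249671239665, -4777504640325,
   -1023073117020],
   [4711504642000, 29380525547105, 9346021470975, -16699379891990, 6566430941830, -8755756466945,
   -5308403619495, -20005711788845, -3815568985840, -863596385990],
   [45861564861195, 29205916872250, -52089413232420, 20513043273050, -27294545136880,
   -16582042241735, -62421779073550, -11947924674340, -2719838124915],
   [4704705897395, -16637515852880, 6457360313855, -8629138572015, -5228135663370,
   -19853178927035, -3818633127615, -932712078450],
   [14828118442025, -11581025255570, 15483538062410, 9378146951940, 35459335937550,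
   6757696713395, 1566982325335],
   [2330665008705, -6137630997840, -3746411528790, -13962506266815, -2691414241610,
   -574084666798],
   [4083881129350, 4975852190495, 18593434727200, 3524590878575, 757033441265],
   [1542178401705, 11286968493105, 2108174077100, 417423764905],
   [21247355087465, 8116682392125, 1835439970740],
   [816760508355, 411991644962],
   [79155722900]]

/-- The form in `mulBasis` for the Bernstein coefficient of `s²`,
`ω ∈ [1, 21/20]`. -/
def highGram2Mul : List (List ℤ) :=
  [[62449670063720, 127748904265630, -234968377379980, -154788190806545, 12993828161530,
   -193053312568900, -88988434189005, 329031710463440, 174963383385620],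
   [65337695176500, -240580337708975, -158441560528925, 13448950436665, -197280783909695,
   -91144403300120, 336655859892840, 178954623850580],
   [223848694565935, 293922092517705, -28052423572535, 359097611868330, 170257246314355,
   -621550394323680, -329073588416210],
   [96571406951030, -17837990618325, 237291018231485, 111653175304310, -409006401930745,
   -216799530781090],
   [1827352197905, -17469291078790, -11073491208415, 35850049144595, 18145004030380],
   [150689633237350, 135487552489790, -506759088804575, -270514881449840],
   [32417466341255, -235710250550000, -124615772906400],
   [433986516335175, 460903981924530],
   [122555755307410]]

/-! ### Gram identities for the derivatives -/

set_option maxHeartbeats 4000000 in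
/-- The coefficient of `(1 - s)²` in the derivative of `(1 - s) midLyap0 + s midLyap1` at
`ω = (1 - s) ω₀ + s ω₁`, where `[ω₀, ω₁] = [11/20, 1]`. -/
lemma scaledLie_mid_bernstein0 (x y z : ℝ) :
    -5 * (scaledLie midLyap0 (11 / 20) x y z) =
      y ^ 2 + z ^ 2 + (x - x ^ 3) ^ 2 + quadForm midGram0Odd (oddBasis x y z) +
        quadForm midGram0Even (evenBasis x y z) +
        (x ^ 2 - z) * quadForm midGram0Mul (mulBasis x y z) := by
  simp only [scaledLie, polyDeriv, midLyap0, midGram0Odd, midGram0Even,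
    midGram0Mul, oddBasis, evenBasis, mulBasis, quadForm, intDot, List.map_cons, List.map_nil,
    List.sum_cons, List.sum_nil]
  push_cast
  ring

set_option maxHeartbeats 4000000 in
/-- The coefficient of `s (1 - s)` in the derivative of `(1 - s) midLyap0 + s midLyap1` at
`ω = (1 - s) ω₀ + s ω₁`, where `[ω₀, ω₁] = [11/20, 1]`. -/
lemma scaledLie_mid_bernstein1 (x y z : ℝ) :
    -5 * (scaledLie midLyap1 (11 / 20) x y z + scaledLie midLyap0 1 x y z) =
      y ^ 2 + z ^ 2 + (x - x ^ 3) ^ 2 + quadForm midGram1Odd (oddBasis x y z) +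
        quadForm midGram1Even (evenBasis x y z) +
        (x ^ 2 - z) * quadForm midGram1Mul (mulBasis x y z) := by
  simp only [scaledLie, polyDeriv, midLyap0, midLyap1, midGram1Odd, midGram1Even,
    midGram1Mul, oddBasis, evenBasis, mulBasis, quadForm, intDot, List.map_cons, List.map_nil,
    List.sum_cons, List.sum_nil]
  push_cast
  ring

set_option maxHeartbeats 4000000 in
/-- The coefficient of `s²` in the derivative of `(1 - s) midLyap0 + s midLyap1` at
`ω = (1 - s) ω₀ + s ω₁`, where `[ω₀, ω₁] = [11/20, 1]`. -/
lemma scaledLie_mid_bernstein2 (x y z : ℝ) :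
    -5 * (scaledLie midLyap1 1 x y z) =
      y ^ 2 + z ^ 2 + (x - x ^ 3) ^ 2 + quadForm midGram2Odd (oddBasis x y z) +
        quadForm midGram2Even (evenBasis x y z) +
        (x ^ 2 - z) * quadForm midGram2Mul (mulBasis x y z) := by
  simp only [scaledLie, polyDeriv, midLyap1, midGram2Odd, midGram2Even,
    midGram2Mul, oddBasis, evenBasis, mulBasis, quadForm, intDot, List.map_cons, List.map_nil,
    List.sum_cons, List.sum_nil]
  push_cast
  ring

set_option maxHeartbeats 4000000 in
/-- The coefficient of `(1 - s)²` in the derivative of `(1 - s) highLyap0 + s highLyap1` at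
`ω = (1 - s) ω₀ + s ω₁`, where `[ω₀, ω₁] = [1, 21/20]`. -/
lemma scaledLie_high_bernstein0 (x y z : ℝ) :
    -5 * (scaledLie highLyap0 1 x y z) =
      y ^ 2 + z ^ 2 + (x - x ^ 3) ^ 2 + quadForm highGram0Odd (oddBasis x y z) +
        quadForm highGram0Even (evenBasis x y z) +
        (x ^ 2 - z) * quadForm highGram0Mul (mulBasis x y z) := by
  simp only [scaledLie, polyDeriv, highLyap0, highGram0Odd, highGram0Even,
    highGram0Mul, oddBasis, evenBasis, mulBasis, quadForm, intDot, List.map_cons, List.map_nil,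
    List.sum_cons, List.sum_nil]
  push_cast
  ring

set_option maxHeartbeats 4000000 in
/-- The coefficient of `s (1 - s)` in the derivative of `(1 - s) highLyap0 + s highLyap1` at
`ω = (1 - s) ω₀ + s ω₁`, where `[ω₀, ω₁] = [1, 21/20]`. -/
lemma scaledLie_high_bernstein1 (x y z : ℝ) :
    -5 * (scaledLie highLyap1 1 x y z + scaledLie highLyap0 (21 / 20) x y z) =
      y ^ 2 + z ^ 2 + (x - x ^ 3) ^ 2 + quadForm highGram1Odd (oddBasis x y z) +
        quadForm highGram1Even (evenBasis x y z) +
        (x ^ 2 - z) * quadForm highGram1Mul (mulBasis x y z) := by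
  simp only [scaledLie, polyDeriv, highLyap0, highLyap1, highGram1Odd, highGram1Even,
    highGram1Mul, oddBasis, evenBasis, mulBasis, quadForm, intDot, List.map_cons, List.map_nil,
    List.sum_cons, List.sum_nil]
  push_cast
  ring

set_option maxHeartbeats 4000000 in
/-- The coefficient of `s²` in the derivative of `(1 - s) highLyap0 + s highLyap1` at
`ω = (1 - s) ω₀ + s ω₁`, where `[ω₀, ω₁] = [1, 21/20]`. -/
lemma scaledLie_high_bernstein2 (x y z : ℝ) :
    -5 * (scaledLie highLyap1 (21 / 20) x y z) =
      y ^ 2 + z ^ 2 + (x - x ^ 3) ^ 2 + quadForm highGram2Odd (oddBasis x y z) +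
        quadForm highGram2Even (evenBasis x y z) +
        (x ^ 2 - z) * quadForm highGram2Mul (mulBasis x y z) := by
  simp only [scaledLie, polyDeriv, highLyap1, highGram2Odd, highGram2Even,
    highGram2Mul, oddBasis, evenBasis, mulBasis, quadForm, intDot, List.map_cons, List.map_nil,
    List.sum_cons, List.sum_nil]
  push_cast
  ring

set_option maxHeartbeats 4000000 in
lemma lowLie_lowLyap (q x y z : ℝ) :
    -1620 * (lowLie lowLyap0 q x y z + q * lowLie lowLyap1 q x y z +
        q ^ 2 * lowLie lowLyap2 q x y z) =
      (61 - 20 * q) * (y ^ 2 + z ^ 2 + (2 * q * x - 3 * x ^ 3) ^ 2 +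
        quadForm lowGram0Odd (lowOddBasis q x y z) + quadForm lowGram0Even (lowEvenBasis q x y z) +
        (13 * x ^ 2 - 10 * z) * quadForm lowGram0Mul (lowMulBasis q x y z)) +
      (q + 1) * (y ^ 2 + z ^ 2 + (2 * q * x - 3 * x ^ 3) ^ 2 +
        quadForm lowGram1Odd (lowOddBasis q x y z) + quadForm lowGram1Even (lowEvenBasis q x y z) +
        (13 * x ^ 2 - 10 * z) * quadForm lowGram1Mul (lowMulBasis q x y z)) := by
  simp only [lowLie, polyDeriv, lowLyap0, lowLyap1, lowLyap2, lowGram0Odd, lowGram0Even,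
    lowGram0Mul, lowGram1Odd, lowGram1Even, lowGram1Mul, lowOddBasis, lowEvenBasis, lowMulBasis,
    quadForm, intDot, List.map_cons, List.map_nil, List.sum_cons, List.sum_nil]
  push_cast
  ring

/-! ### Positivity of the Gram forms -/

lemma midGram0Odd_nonneg (x y z : ℝ) :
    0 ≤ quadForm midGram0Odd (oddBasis x y z) :=
  quadForm_nonneg 13 _ (by decide +kernel) (by decide +kernel) _ rfl

lemma midGram0Even_nonneg (x y z : ℝ) :
    0 ≤ quadForm midGram0Even (evenBasis x y z) :=
  quadForm_nonneg 14 _ (by decide +kernel) (by decide +kernel) _ rfl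

lemma midGram0Mul_nonneg (x y z : ℝ) :
    0 ≤ quadForm midGram0Mul (mulBasis x y z) :=
  quadForm_nonneg 9 _ (by decide +kernel) (by decide +kernel) _ rfl

lemma midGram1Odd_nonneg (x y z : ℝ) :
    0 ≤ quadForm midGram1Odd (oddBasis x y z) :=
  quadForm_nonneg 13 _ (by decide +kernel) (by decide +kernel) _ rfl

lemma midGram1Even_nonneg (x y z : ℝ) :
    0 ≤ quadForm midGram1Even (evenBasis x y z) :=
  quadForm_nonneg 14 _ (by decide +kernel) (by decide +kernel) _ rfl

lemma midGram1Mul_nonneg (x y z : ℝ) :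
    0 ≤ quadForm midGram1Mul (mulBasis x y z) :=
  quadForm_nonneg 9 _ (by decide +kernel) (by decide +kernel) _ rfl

lemma midGram2Odd_nonneg (x y z : ℝ) :
    0 ≤ quadForm midGram2Odd (oddBasis x y z) :=
  quadForm_nonneg 13 _ (by decide +kernel) (by decide +kernel) _ rfl

lemma midGram2Even_nonneg (x y z : ℝ) :
    0 ≤ quadForm midGram2Even (evenBasis x y z) :=
  quadForm_nonneg 14 _ (by decide +kernel) (by decide +kernel) _ rfl

lemma midGram2Mul_nonneg (x y z : ℝ) :
    0 ≤ quadForm midGram2Mul (mulBasis x y z) :=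
  quadForm_nonneg 9 _ (by decide +kernel) (by decide +kernel) _ rfl

lemma highGram0Odd_nonneg (x y z : ℝ) :
    0 ≤ quadForm highGram0Odd (oddBasis x y z) :=
  quadForm_nonneg 13 _ (by decide +kernel) (by decide +kernel) _ rfl

lemma highGram0Even_nonneg (x y z : ℝ) :
    0 ≤ quadForm highGram0Even (evenBasis x y z) :=
  quadForm_nonneg 14 _ (by decide +kernel) (by decide +kernel) _ rfl

lemma highGram0Mul_nonneg (x y z : ℝ) :
    0 ≤ quadForm highGram0Mul (mulBasis x y z) :=
  quadForm_nonneg 9 _ (by decide +kernel) (by decide +kernel) _ rfl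

lemma highGram1Odd_nonneg (x y z : ℝ) :
    0 ≤ quadForm highGram1Odd (oddBasis x y z) :=
  quadForm_nonneg 13 _ (by decide +kernel) (by decide +kernel) _ rfl

lemma highGram1Even_nonneg (x y z : ℝ) :
    0 ≤ quadForm highGram1Even (evenBasis x y z) :=
  quadForm_nonneg 14 _ (by decide +kernel) (by decide +kernel) _ rfl

lemma highGram1Mul_nonneg (x y z : ℝ) :
    0 ≤ quadForm highGram1Mul (mulBasis x y z) :=
  quadForm_nonneg 9 _ (by decide +kernel) (by decide +kernel) _ rfl

lemma highGram2Odd_nonneg (x y z : ℝ) :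
    0 ≤ quadForm highGram2Odd (oddBasis x y z) :=
  quadForm_nonneg 13 _ (by decide +kernel) (by decide +kernel) _ rfl

lemma highGram2Even_nonneg (x y z : ℝ) :
    0 ≤ quadForm highGram2Even (evenBasis x y z) :=
  quadForm_nonneg 14 _ (by decide +kernel) (by decide +kernel) _ rfl

lemma highGram2Mul_nonneg (x y z : ℝ) :
    0 ≤ quadForm highGram2Mul (mulBasis x y z) :=
  quadForm_nonneg 9 _ (by decide +kernel) (by decide +kernel) _ rfl

lemma lowGram0Odd_nonneg (q x y z : ℝ) :
    0 ≤ quadForm lowGram0Odd (lowOddBasis q x y z) :=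
  quadForm_nonneg 5 _ (by decide +kernel) (by decide +kernel) _ rfl

lemma lowGram0Even_nonneg (q x y z : ℝ) :
    0 ≤ quadForm lowGram0Even (lowEvenBasis q x y z) :=
  quadForm_nonneg 6 _ (by decide +kernel) (by decide +kernel) _ rfl

lemma lowGram0Mul_nonneg (q x y z : ℝ) :
    0 ≤ quadForm lowGram0Mul (lowMulBasis q x y z) :=
  quadForm_nonneg 3 _ (by decide +kernel) (by decide +kernel) _ rfl

lemma lowGram1Odd_nonneg (q x y z : ℝ) :
    0 ≤ quadForm lowGram1Odd (lowOddBasis q x y z) :=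
  quadForm_nonneg 5 _ (by decide +kernel) (by decide +kernel) _ rfl

lemma lowGram1Even_nonneg (q x y z : ℝ) :
    0 ≤ quadForm lowGram1Even (lowEvenBasis q x y z) :=
  quadForm_nonneg 6 _ (by decide +kernel) (by decide +kernel) _ rfl

lemma lowGram1Mul_nonneg (q x y z : ℝ) :
    0 ≤ quadForm lowGram1Mul (lowMulBasis q x y z) :=
  quadForm_nonneg 3 _ (by decide +kernel) (by decide +kernel) _ rfl

/-! ### Global existence for dissipative vector fields -/

section Existence

variable {E : Type*} [NormedAddCommGroup E] [NormedSpace ℝ E]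

/-- A solution cannot leave a sublevel set of `φ` through a boundary on which `φ` decreases strictly
along the field. -/
lemma sublevel_of_solution {f : E → E} {φ : E → ℝ} (hφ : Differentiable ℝ φ) {c : ℝ}
    (h : ∀ p, φ p = c → fderiv ℝ φ p (f p) < 0) {x : ℝ → E} {T : ℝ}
    (hx : ∀ t ∈ Icc 0 T, HasDerivWithinAt x (f (x t)) (Icc 0 T) t) (h0 : φ (x 0) ≤ c) :
    ∀ t ∈ Icc 0 T, φ (x t) ≤ c := by
  have hd : ∀ t ∈ Icc 0 T,
      HasDerivWithinAt (fun t => φ (x t)) (fderiv ℝ φ (x t) (f (x t))) (Icc 0 T) t := fun t ht =>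
    (hφ (x t)).hasFDerivAt.comp_hasDerivWithinAt t (hx t ht)
  refine image_le_of_deriv_right_lt_deriv_boundary' (f := fun t => φ (x t)) (B := fun _ => c)
    (B' := fun _ => 0) (fun t ht => (hd t ht).continuousWithinAt)
    (fun t ht => (hd t ⟨ht.1, ht.2.le⟩).mono_of_mem_nhdsWithin (Icc_mem_nhdsGE_of_mem ht)) h0
    continuousOn_const (fun t _ => hasDerivWithinAt_const t _ c) (fun t _ ht => h _ ht)

lemma IsTrajectory.hasDerivWithinAt_Icc {f : E → E} {x : ℝ → E} (hx : IsTrajectory f x) {T t : ℝ}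
    (ht : t ∈ Icc 0 T) : HasDerivWithinAt x (f (x t)) (Icc 0 T) t :=
  (hx t ht.1).mono Icc_subset_Ici_self

lemma IsTrajectory.sublevel {f : E → E} {φ : E → ℝ} (hφ : Differentiable ℝ φ) {c : ℝ}
    (h : ∀ p, φ p = c → fderiv ℝ φ p (f p) < 0) {x : ℝ → E} (hx : IsTrajectory f x)
    (h0 : φ (x 0) ≤ c) {t : ℝ} (ht : 0 ≤ t) : φ (x t) ≤ c :=
  sublevel_of_solution hφ h (T := t) (fun _ hs => hx.hasDerivWithinAt_Icc hs) h0 t ⟨ht, le_rfl⟩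

lemma eqOn_of_solution {g : E → E} {K : NNReal} (hg : LipschitzWith K g) {x y : ℝ → E} {T : ℝ}
    (hx : ∀ t ∈ Icc 0 T, HasDerivWithinAt x (g (x t)) (Icc 0 T) t)
    (hy : ∀ t ∈ Icc 0 T, HasDerivWithinAt y (g (y t)) (Icc 0 T) t) (h0 : x 0 = y 0) :
    EqOn x y (Icc 0 T) :=
  ODE_solution_unique (v := fun _ => g) (fun _ => hg)
    (fun t ht => (hx t ht).continuousWithinAt)
    (fun t ht => (hx t ⟨ht.1, ht.2.le⟩).mono_of_mem_nhdsWithin (Icc_mem_nhdsGE_of_mem ht))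
    (fun t ht => (hy t ht).continuousWithinAt)
    (fun t ht => (hy t ⟨ht.1, ht.2.le⟩).mono_of_mem_nhdsWithin (Icc_mem_nhdsGE_of_mem ht)) h0

/-- Boundedness of the field makes the Picard–Lindelöf existence time arbitrarily long. -/
lemma exists_trajectory_of_lipschitz [CompleteSpace E] {g : E → E} {K L : NNReal}
    (hK : LipschitzWith K g) (hL : ∀ p, ‖g p‖ ≤ L) (x₀ : E) :
    ∃ x : ℝ → E, IsTrajectory g x ∧ x 0 = x₀ := by
  have hex : ∀ n : ℕ, ∃ x : ℝ → E, x 0 = x₀ ∧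
      ∀ t ∈ Icc (0 : ℝ) n, HasDerivWithinAt x (g (x t)) (Icc (0 : ℝ) n) t := by
    intro n
    have hpl : IsPicardLindelof (fun _ => g) (tmin := 0) (tmax := n)
        ⟨0, ⟨le_rfl, n.cast_nonneg⟩⟩ x₀ (L * n) 0 L K :=
      { lipschitzOnWith := fun _ _ => hK.lipschitzOnWith
        continuousOn := fun _ _ => continuousOn_const
        norm_le := fun _ _ p _ => hL p
        mul_max_le := by simp }
    exact hpl.exists_eq_forall_mem_Icc_hasDerivWithinAt₀
  choose x hx0 hx using hex
  have heq : ∀ m n : ℕ, m ≤ n → EqOn (x m) (x n) (Icc 0 m) := fun m n hmn =>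
    eqOn_of_solution hK (hx m)
      (fun t ht => (hx n t ⟨ht.1, ht.2.trans (by exact_mod_cast hmn)⟩).mono
        (Icc_subset_Icc_right (by exact_mod_cast hmn))) ((hx0 m).trans (hx0 n).symm)
  -- the solutions on `[0, n]` are glued along `n = ⌈t⌉`
  have hglue : ∀ (n : ℕ) (t : ℝ), t ∈ Icc (0 : ℝ) n → x ⌈t⌉₊ t = x n t := fun n t ht =>
    heq ⌈t⌉₊ n (Nat.ceil_le.mpr ht.2) ⟨ht.1, Nat.le_ceil t⟩
  refine ⟨fun t => x ⌈t⌉₊ t, fun t ht => ?_, by simpa using hx0 0⟩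
  obtain ⟨n, hn⟩ := exists_nat_gt t
  have hmem : t ∈ Icc (0 : ℝ) n := ⟨ht, hn.le⟩
  have h1 := (hx n t hmem).congr (fun s hs => hglue n s hs) (hglue n t hmem)
  rw [← hglue n t hmem] at h1
  refine h1.mono_of_mem_nhdsWithin ?_
  rw [← Ici_inter_Iic]
  exact inter_mem self_mem_nhdsWithin (mem_nhdsWithin_of_mem_nhds (Iic_mem_nhds hn))

/-- If `φ` decreases strictly along `f` on the boundary of a bounded sublevel set, then the
solutions starting in this set are global: the field may be cut off away from the set, which stays
invariant. -/
theorem exists_trajectory_of_dissipative [FiniteDimensional ℝ E] {f : E → E} (hf : ContDiff ℝ 1 f)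
    {φ : E → ℝ} (hφ : Differentiable ℝ φ) {c : ℝ} (hc : Bornology.IsBounded {p | φ p ≤ c})
    (h : ∀ p, φ p = c → fderiv ℝ φ p (f p) < 0) {x₀ : E} (h0 : φ x₀ ≤ c) :
    ∃ x : ℝ → E, IsTrajectory f x ∧ x 0 = x₀ := by
  obtain ⟨R, hR0, hR⟩ := hc.exists_pos_norm_le
  have : CompleteSpace E := FiniteDimensional.complete ℝ E
  let χ : ContDiffBump (0 : E) := ⟨R, R + 1, hR0, by linarith⟩
  have hχ : ∀ p, φ p ≤ c → χ p = 1 := fun p hp =>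
    χ.one_of_mem_closedBall (by simpa using hR p hp)
  let g : E → E := fun p => χ p • f p
  have hg : ContDiff ℝ 1 g := χ.contDiff.smul hf
  have hgs : HasCompactSupport g := χ.hasCompactSupport.smul_right
  obtain ⟨K, hK⟩ := hg.lipschitzWith_of_hasCompactSupport hgs one_ne_zero
  obtain ⟨L, hL⟩ := hgs.exists_bound_of_continuous hg.continuous
  have hgf : ∀ p, φ p ≤ c → g p = f p := fun p hp => by simp [g, hχ p hp]
  obtain ⟨x, hx, hx0⟩ := exists_trajectory_of_lipschitz (L := L.toNNReal) hK
    (fun p => (hL p).trans (Real.le_coe_toNNReal L)) x₀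
  have hmem : ∀ t, 0 ≤ t → φ (x t) ≤ c := fun t ht =>
    hx.sublevel hφ (fun p hp => by rw [hgf p hp.le]; exact h p hp) (by rwa [hx0]) ht
  exact ⟨x, fun t ht => by simpa only [hgf _ (hmem t ht)] using hx t ht, hx0⟩

/-- An equilibrium is the only trajectory through it. -/
lemma IsTrajectory.eq_of_equilibrium [FiniteDimensional ℝ E] {f : E → E} (hf : ContDiff ℝ 1 f)
    {x : ℝ → E} (hx : IsTrajectory f x) (h0 : f (x 0) = 0) {t : ℝ} (ht : 0 ≤ t) : x t = x 0 := by
  have : CompleteSpace E := FiniteDimensional.complete ℝ E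
  have hcont : ContinuousOn x (Icc 0 t) := fun s hs =>
    (hx.hasDerivWithinAt_Icc hs).continuousWithinAt
  obtain ⟨R, hR0, hR⟩ := (isCompact_Icc.image_of_continuousOn hcont).isBounded.exists_pos_norm_le
  let χ : ContDiffBump (0 : E) := ⟨R, R + 1, hR0, by linarith⟩
  let g : E → E := fun p => χ p • f p
  have hg : ContDiff ℝ 1 g := χ.contDiff.smul hf
  obtain ⟨K, hK⟩ : ∃ K, LipschitzWith K g :=
    hg.lipschitzWith_of_hasCompactSupport χ.hasCompactSupport.smul_right one_ne_zero
  have hgx : ∀ s ∈ Icc 0 t, g (x s) = f (x s) := fun s hs => by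
    have : χ (x s) = 1 := χ.one_of_mem_closedBall (by simpa using hR _ (mem_image_of_mem x hs))
    simp [g, this]
  refine eqOn_of_solution (y := fun _ => x 0) hK (T := t)
    (fun s hs => by rw [hgx s hs]; exact hx.hasDerivWithinAt_Icc hs)
    (fun s _ => ?_) rfl ⟨ht, le_rfl⟩
  have : g (x 0) = 0 := by simp [g, h0]
  rw [this]
  exact hasDerivWithinAt_const s _ _

end Existence

/-! ### Decay along bounded trajectories -/

/-- Barbalat's lemma for a function that is dissipated: if `U` is bounded below and `U' ≤ -g(x)`,
then `g(x)` tends to zero along the bounded trajectory `x`. -/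
theorem tendsto_zero_of_deriv_le {E : Type*} [NormedAddCommGroup E] [NormedSpace ℝ E]
    [ProperSpace E] {f : E → E} (hf : Continuous f) {x : ℝ → E} (hx : IsTrajectory f x) {R : ℝ}
    (hR : ∀ t, 0 ≤ t → ‖x t‖ ≤ R) {g : E → ℝ} (hg : Continuous g) (hg0 : ∀ p, 0 ≤ g p)
    {U U' : ℝ → ℝ} (hU : ∀ t, 0 ≤ t → HasDerivWithinAt U (U' t) (Ici 0) t)
    (hU' : ∀ t, 0 ≤ t → U' t ≤ -g (x t)) {m : ℝ} (hm : ∀ t, 0 ≤ t → m ≤ U t) :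
    Tendsto (fun t => g (x t)) atTop (𝓝 0) := by
  have hK : IsCompact (Metric.closedBall (0 : E) R) := isCompact_closedBall 0 R
  obtain ⟨L, hL⟩ := hK.exists_bound_of_continuousOn hf.continuousOn
  have hxK : ∀ t, 0 ≤ t → x t ∈ Metric.closedBall (0 : E) R := fun t ht => by simpa using hR t ht
  have hlip : ∀ s t, 0 ≤ s → 0 ≤ t → ‖x t - x s‖ ≤ L * ‖t - s‖ := fun s t hs ht =>
    (convex_Ici 0).norm_image_sub_le_of_norm_hasDerivWithin_le (fun t ht => hx t ht)
      (fun t ht => hL _ (hxK t ht)) hs ht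
  have huc := hK.uniformContinuousOn_of_continuous hg.continuousOn
  have hUc : ContinuousOn U (Ici 0) := fun t ht => (hU t ht).continuousWithinAt
  have hint : ∀ t ∈ interior (Ici (0 : ℝ)), HasDerivAt U (U' t) t := fun t ht => by
    rw [interior_Ici] at ht
    exact (hU t (le_of_lt ht)).hasDerivAt (Ici_mem_nhds ht)
  have hanti : AntitoneOn U (Ici 0) := by
    refine antitoneOn_of_deriv_nonpos (convex_Ici 0) hUc
      (fun t ht => (hint t ht).differentiableAt.differentiableWithinAt) fun t ht => ?_
    rw [(hint t ht).deriv]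
    rw [interior_Ici] at ht
    linarith [hU' t (le_of_lt ht), hg0 (x t)]
  by_contra hcon
  rw [Metric.tendsto_atTop] at hcon
  push Not at hcon
  obtain ⟨ε, hε, hfreq⟩ := hcon
  obtain ⟨δ, hδ, hδg⟩ := Metric.uniformContinuousOn_iff.mp huc (ε / 2) (by positivity)
  have hL0 : 0 ≤ L := (norm_nonneg _).trans (hL _ (hxK 0 le_rfl))
  -- on an interval of length `h` behind a time where `ε ≤ g`, the function stays above `ε / 2`
  set h := δ / (L + 1) with hh
  have hhpos : 0 < h := by positivity
  have hdrop : ∀ t, 0 ≤ t → ε ≤ g (x t) → U (t + h) ≤ U t - ε / 2 * h := by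
    intro t ht hgt
    have hsub : Icc t (t + h) ⊆ Ici 0 := fun s hs => ht.trans hs.1
    have hlow : ∀ s ∈ interior (Icc t (t + h)), deriv U s ≤ -(ε / 2) := by
      intro s hs
      rw [interior_Icc] at hs
      have hs0 : 0 < s := ht.trans_lt hs.1
      rw [(hint s (by rwa [interior_Ici])).deriv]
      have hd : dist (x t) (x s) < δ := by
        rw [dist_eq_norm]
        have h1 := hlip s t hs0.le ht
        have h2 : ‖t - s‖ ≤ h := by
          rw [Real.norm_eq_abs, abs_le]
          constructor <;> linarith [hs.1, hs.2]
        calc ‖x t - x s‖ ≤ L * h := h1.trans (mul_le_mul_of_nonneg_left h2 hL0)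
          _ < (L + 1) * h := by linarith
          _ = δ := by rw [hh]; field_simp
      have h3 := hδg _ (hxK t ht) _ (hxK s hs0.le) hd
      rw [Real.dist_eq, abs_lt] at h3
      linarith [hU' s hs0.le, h3.2]
    have := (convex_Icc t (t + h)).image_sub_le_mul_sub_of_deriv_le (hUc.mono hsub)
      (fun s hs => (hint s (interior_mono hsub hs)).differentiableAt.differentiableWithinAt) hlow t
      (left_mem_Icc.mpr (by linarith)) (t + h) (right_mem_Icc.mpr (by linarith)) (by linarith)
    linarith
  have hiter : ∀ n : ℕ, ∃ t, 0 ≤ t ∧ U t ≤ U 0 - n * (ε / 2 * h) := by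
    intro n
    induction n with
    | zero => exact ⟨0, le_rfl, by simp⟩
    | succ n ih =>
      obtain ⟨t, ht, hUt⟩ := ih
      obtain ⟨s, hs, hgs⟩ := hfreq t
      rw [Real.dist_eq, sub_zero, abs_of_nonneg (hg0 _)] at hgs
      refine ⟨s + h, by linarith, ?_⟩
      have h1 := hdrop s (by linarith) hgs
      have h2 := hanti (mem_Ici.mpr ht) (mem_Ici.mpr (ht.trans hs)) hs
      push_cast
      linarith
  obtain ⟨n, hn⟩ := exists_nat_gt ((U 0 - m) / (ε / 2 * h))
  obtain ⟨t, ht, hUt⟩ := hiter n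
  rw [div_lt_iff₀ (by positivity)] at hn
  linarith [hm t ht]

/-- A function `V` whose derivative along `f` is at most `-g - w Q`, with `Q ≥ 0`, forces `g → 0`
along a bounded trajectory even if `w` is only bounded below by an exponentially small function:
a multiple of that function is added to `V`. -/
theorem tendsto_zero_of_lyapunov {E : Type*} [NormedAddCommGroup E] [NormedSpace ℝ E]
    [ProperSpace E] {f : E → E} (hf : Continuous f) {x : ℝ → E} (hx : IsTrajectory f x) {R : ℝ}
    (hR : ∀ t, 0 ≤ t → ‖x t‖ ≤ R) {V V' g w Q : E → ℝ} (hV : Continuous V) (hg : Continuous g)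
    (hQ : Continuous Q) (hg0 : ∀ p, 0 ≤ g p) (hQ0 : ∀ p, 0 ≤ Q p)
    (hVx : ∀ t, 0 ≤ t → HasDerivWithinAt (fun t => V (x t)) (V' (x t)) (Ici 0) t)
    (hV' : ∀ p, V' p ≤ -g p - w p * Q p) {C k : ℝ} (hC : 0 ≤ C) (hk : 0 < k)
    (hw : ∀ t, 0 ≤ t → -(C * Real.exp (-(k * t))) ≤ w (x t)) :
    Tendsto (fun t => g (x t)) atTop (𝓝 0) := by
  have hK : IsCompact (Metric.closedBall (0 : E) R) := isCompact_closedBall 0 R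
  have hxK : ∀ t, 0 ≤ t → x t ∈ Metric.closedBall (0 : E) R := fun t ht => by simpa using hR t ht
  obtain ⟨M, hM⟩ := hK.exists_bound_of_continuousOn hQ.continuousOn
  obtain ⟨N, hN⟩ := hK.exists_bound_of_continuousOn hV.continuousOn
  have hM0 : 0 ≤ M := (norm_nonneg _).trans (hM _ (hxK 0 le_rfl))
  have hexp : ∀ t : ℝ, HasDerivAt (fun t => C * M / k * Real.exp (-(k * t)))
      (-(C * M * Real.exp (-(k * t)))) t := fun t => by
    have h1 : HasDerivAt (fun t : ℝ => -(k * t)) (-k) t := by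
      simpa [neg_mul] using (hasDerivAt_id' t).const_mul (-k)
    refine (h1.exp.const_mul (C * M / k)).congr_deriv ?_
    field_simp
  refine tendsto_zero_of_deriv_le hf hx hR hg hg0
    (U := fun t => V (x t) + C * M / k * Real.exp (-(k * t)))
    (fun t ht => (hVx t ht).add (hexp t).hasDerivWithinAt) (fun t ht => ?_) (m := -N)
    (fun t ht => ?_)
  · have h1 := hM _ (hxK t ht)
    rw [Real.norm_eq_abs, abs_of_nonneg (hQ0 _)] at h1
    have he := Real.exp_pos (-(k * t))
    have h2 : -(C * Real.exp (-(k * t)) * M) ≤ w (x t) * Q (x t) := by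
      have h3 := mul_le_mul_of_nonneg_right (hw t ht) (hQ0 (x t))
      have h4 := mul_le_mul_of_nonneg_left h1 (mul_nonneg hC he.le)
      linarith
    linarith [hV' (x t)]
  · have h1 := (abs_le.mp (hN _ (hxK t ht))).1
    have : 0 ≤ C * M / k * Real.exp (-(k * t)) := by positivity
    linarith

/-! ### The Lorenz field -/

lemma lorenzField_zero (σ β ρ : ℝ) (p : EuclideanSpace ℝ (Fin 3)) :
    lorenzField σ β ρ p 0 = σ * (p 1 - p 0) := rfl

lemma lorenzField_one (σ β ρ : ℝ) (p : EuclideanSpace ℝ (Fin 3)) :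
    lorenzField σ β ρ p 1 = p 0 * (ρ - p 2) - p 1 := rfl

lemma lorenzField_two (σ β ρ : ℝ) (p : EuclideanSpace ℝ (Fin 3)) :
    lorenzField σ β ρ p 2 = p 0 * p 1 - β * p 2 := rfl

lemma contDiff_lorenzField (σ β ρ : ℝ) : ContDiff ℝ 1 (lorenzField σ β ρ) := by
  rw [contDiff_euclidean]
  intro i
  fin_cases i <;> simp only [Fin.zero_eta, Fin.mk_one, Fin.reduceFinMk, lorenzField_zero,
    lorenzField_one, lorenzField_two] <;> fun_prop

lemma mem_equilibria_lorenz {ρ : ℝ} {p : EuclideanSpace ℝ (Fin 3)} :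
    p ∈ equilibria (lorenzField 10 (8 / 3) ρ) ↔
      p 1 = p 0 ∧ p 2 = 3 / 8 * p 0 ^ 2 ∧ p 0 * (8 / 3 * (ρ - 1) - p 0 ^ 2) = 0 := by
  have h : p ∈ equilibria (lorenzField 10 (8 / 3) ρ) ↔ ∀ i, lorenzField 10 (8 / 3) ρ p i = 0 := by
    rw [equilibria, mem_ofPred_eq]
    exact ⟨fun h i => by rw [h]; rfl, fun h => by ext i; exact h i⟩
  rw [h, Fin.forall_fin_succ, Fin.forall_fin_succ, Fin.forall_fin_succ]
  simp only [Fin.succ_zero_eq_one, Fin.succ_one_eq_two, IsEmpty.forall_iff, and_true,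
    lorenzField_zero, lorenzField_one, lorenzField_two]
  constructor
  · rintro ⟨h0, h1, h2⟩
    have e1 : p 1 = p 0 := by linarith
    rw [e1] at h1 h2
    have e2 : p 2 = 3 / 8 * p 0 ^ 2 := by linarith
    rw [e2] at h1
    exact ⟨e1, e2, by linarith⟩
  · rintro ⟨e1, e2, h⟩
    rw [e1, e2]
    exact ⟨by ring, by linarith, by ring⟩

lemma finite_equilibria_lorenz (ρ : ℝ) : (equilibria (lorenzField 10 (8 / 3) ρ)).Finite := by
  have hfin : {a : ℝ | a * (8 / 3 * (ρ - 1) - a ^ 2) = 0}.Finite := by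
    refine (Set.toFinite {0, √(8 / 3 * (ρ - 1)), -√(8 / 3 * (ρ - 1))}).subset fun a ha => ?_
    rcases mul_eq_zero.mp ha with h | h
    · exact Or.inl h
    · have h1 : a ^ 2 = 8 / 3 * (ρ - 1) := by linarith
      rw [← h1, Real.sqrt_sq_eq_abs]
      rcases abs_choice a with h2 | h2 <;> rw [h2] <;> simp
  refine Set.Finite.of_finite_image (f := fun p => p 0) (hfin.subset ?_) ?_
  · rintro _ ⟨p, hp, rfl⟩
    exact (mem_equilibria_lorenz.mp hp).2.2
  · intro p hp r hr (h0 : p 0 = r 0)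
    obtain ⟨p1, p2, -⟩ := mem_equilibria_lorenz.mp hp
    obtain ⟨r1, r2, -⟩ := mem_equilibria_lorenz.mp hr
    ext i
    fin_cases i
    · exact h0
    · simp [p1, r1, h0]
    · simp [p2, r2, h0]

section Trajectory

variable {σ β ρ : ℝ} {x : ℝ → EuclideanSpace ℝ (Fin 3)}

lemma IsTrajectory.hasDerivWithinAt_apply {f : EuclideanSpace ℝ (Fin 3) → EuclideanSpace ℝ (Fin 3)}
    (hx : IsTrajectory f x) (i : Fin 3) {t : ℝ} (ht : 0 ≤ t) :
    HasDerivWithinAt (fun t => x t i) (f (x t) i) (Ici 0) t :=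
  (EuclideanSpace.proj (𝕜 := ℝ) i).hasFDerivAt.comp_hasDerivWithinAt t (hx t ht)

/-- The squared distance to the centre `(0, 0, ρ + 10)` of an absorbing ball. -/
def lorenzEnergy (ρ : ℝ) (p : EuclideanSpace ℝ (Fin 3)) : ℝ :=
  p 0 ^ 2 + p 1 ^ 2 + (p 2 - (ρ + 10)) ^ 2

lemma differentiable_lorenzEnergy (ρ : ℝ) : Differentiable ℝ (lorenzEnergy ρ) := by
  unfold lorenzEnergy
  fun_prop

/-- The derivative of `lorenzEnergy` along the field is
`-20 x₁² - 2 x₂² - (16/3) x₃² + (16/3) (ρ + 10) x₃`, which is negative far from the origin. -/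
lemma fderiv_lorenzEnergy_neg {ρ c : ℝ} (hc : 2 * (ρ + 10) ^ 2 < c) (p : EuclideanSpace ℝ (Fin 3))
    (hp : lorenzEnergy ρ p = c) :
    fderiv ℝ (lorenzEnergy ρ) p (lorenzField 10 (8 / 3) ρ p) < 0 := by
  have hi : ∀ i, HasFDerivAt (fun p : EuclideanSpace ℝ (Fin 3) => p i)
      (EuclideanSpace.proj (𝕜 := ℝ) i : EuclideanSpace ℝ (Fin 3) →L[ℝ] ℝ) p := fun i =>
    (EuclideanSpace.proj (𝕜 := ℝ) i).hasFDerivAt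
  have h : HasFDerivAt (lorenzEnergy ρ) _ p :=
    (((hi 0).pow 2).add ((hi 1).pow 2)).add (((hi 2).sub_const (ρ + 10)).pow 2)
  rw [h.fderiv]
  simp only [add_apply, smul_apply, PiLp.proj_apply,
    lorenzField_zero, lorenzField_one, lorenzField_two, smul_eq_mul, lorenzEnergy] at hp ⊢
  norm_num at hp ⊢
  nlinarith [sq_nonneg (p 2 - (ρ + 10) / 5), sq_nonneg (p 0)]

lemma isBounded_lorenzEnergy_le (ρ c : ℝ) : Bornology.IsBounded {p | lorenzEnergy ρ p ≤ c} := by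
  refine isBounded_iff_forall_norm_le.mpr ⟨√(2 * c + 2 * (ρ + 10) ^ 2), fun p hp => ?_⟩
  rw [EuclideanSpace.norm_eq]
  refine Real.sqrt_le_sqrt ?_
  simp only [Fin.sum_univ_three, Real.norm_eq_abs, sq_abs]
  simp only [mem_ofPred_eq, lorenzEnergy] at hp
  nlinarith [sq_nonneg (p 2 - 2 * (ρ + 10)), sq_nonneg (p 0), sq_nonneg (p 1)]

theorem lorenz_exists_trajectory (ρ : ℝ) (x₀ : EuclideanSpace ℝ (Fin 3)) :
    ∃ x : ℝ → EuclideanSpace ℝ (Fin 3), IsTrajectory (lorenzField 10 (8 / 3) ρ) x ∧ x 0 = x₀ :=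
  exists_trajectory_of_dissipative (contDiff_lorenzField _ _ _) (differentiable_lorenzEnergy ρ)
    (isBounded_lorenzEnergy_le ρ (lorenzEnergy ρ x₀ + 2 * (ρ + 10) ^ 2 + 1))
    (fun p hp => fderiv_lorenzEnergy_neg
      (by
        unfold lorenzEnergy
        nlinarith [sq_nonneg (x₀ 0), sq_nonneg (x₀ 1), sq_nonneg (x₀ 2 - (ρ + 10))]) p hp)
    (by nlinarith [sq_nonneg (ρ + 10)])

theorem lorenz_bounded (hx : IsTrajectory (lorenzField 10 (8 / 3) ρ) x) :
    ∃ R, ∀ t, 0 ≤ t → ‖x t‖ ≤ R := by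
  obtain ⟨R, hR⟩ := isBounded_iff_forall_norm_le.mp
    (isBounded_lorenzEnergy_le ρ (lorenzEnergy ρ (x 0) + 2 * (ρ + 10) ^ 2 + 1))
  refine ⟨R, fun t ht => hR _ (hx.sublevel (differentiable_lorenzEnergy ρ) (fun p hp => ?_) ?_ ht)⟩
  · refine fderiv_lorenzEnergy_neg ?_ p hp
    unfold lorenzEnergy
    nlinarith [sq_nonneg (x 0 0), sq_nonneg (x 0 1), sq_nonneg (x 0 2 - (ρ + 10))]
  · nlinarith [sq_nonneg (ρ + 10)]

/-- The region `x₁² ≤ 20 x₃` attracts exponentially: `u = x₃ - x₁² / 20` satisfies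
`u' = -(8/3) u + (13/15) x₁²`. -/
theorem lorenz_lower_bound (hx : IsTrajectory (lorenzField 10 (8 / 3) ρ) x) {t : ℝ} (ht : 0 ≤ t) :
    -(|x 0 2 - x 0 0 ^ 2 / 20| * Real.exp (-(8 / 3 * t))) ≤ x t 2 - x t 0 ^ 2 / 20 := by
  have hexp : ∀ s : ℝ,
      HasDerivAt (fun s => Real.exp (8 / 3 * s)) (Real.exp (8 / 3 * s) * (8 / 3)) s := fun s =>
    by simpa using ((hasDerivAt_id' s).const_mul (8 / 3 : ℝ)).exp
  have hd : ∀ s, 0 ≤ s → HasDerivWithinAt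
      (fun s => (x s 2 - x s 0 ^ 2 / 20) * Real.exp (8 / 3 * s))
      (13 / 15 * x s 0 ^ 2 * Real.exp (8 / 3 * s)) (Ici 0) s := fun s hs => by
    have h := (((hx.hasDerivWithinAt_apply 2 hs).sub
      (((hx.hasDerivWithinAt_apply 0 hs).pow 2).div_const 20)).mul (hexp s).hasDerivWithinAt)
    refine h.congr_deriv ?_
    simp only [lorenzField_zero, lorenzField_two, Pi.sub_apply, Pi.pow_apply]
    push_cast
    ring
  have hmono : MonotoneOn (fun s => (x s 2 - x s 0 ^ 2 / 20) * Real.exp (8 / 3 * s)) (Ici 0) := by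
    refine monotoneOn_of_deriv_nonneg (convex_Ici 0)
      (fun s hs => (hd s hs).continuousWithinAt) ?_ ?_
    all_goals
      intro s hs
      rw [interior_Ici] at hs
      have h := (hd s (le_of_lt hs)).hasDerivAt (Ici_mem_nhds hs)
    · exact h.differentiableAt.differentiableWithinAt
    · rw [h.deriv]
      positivity
  have h := hmono (mem_Ici.mpr le_rfl) (mem_Ici.mpr ht) ht
  simp only [mul_zero, Real.exp_zero, mul_one] at h
  have h1 : -|x 0 2 - x 0 0 ^ 2 / 20| ≤ (x t 2 - x t 0 ^ 2 / 20) * Real.exp (8 / 3 * t) :=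
    (neg_abs_le _).trans h
  have h2 := mul_le_mul_of_nonneg_right h1 (Real.exp_pos (-(8 / 3 * t))).le
  rwa [mul_assoc, ← Real.exp_add, add_neg_cancel, Real.exp_zero, mul_one, neg_mul] at h2

end Trajectory

/-! ### From small residuals to convergence -/

/-- A continuous function `h` with `h (q - h²) → 0` converges to a root of `X (q - X²)`: it cannot
keep crossing the values where this polynomial is away from zero. -/
lemma exists_tendsto_of_cubic {h : ℝ → ℝ} (hc : ContinuousOn h (Ici 0)) {q : ℝ}
    (hlim : Tendsto (fun t => h t * (q - h t ^ 2)) atTop (𝓝 0)) :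
    ∃ e, e * (q - e ^ 2) = 0 ∧ Tendsto h atTop (𝓝 e) := by
  rcases le_or_gt q 0 with hq | hq
  · refine ⟨0, by simp, ?_⟩
    have h3 : Tendsto (fun t => |h t| ^ 3) atTop (𝓝 0) := by
      refine squeeze_zero (fun t => by positivity) (fun t => ?_) (by simpa using hlim.abs)
      rw [pow_succ' |h t| 2, sq_abs]
      refine mul_le_mul_of_nonneg_left ?_ (abs_nonneg _)
      rw [abs_of_nonpos (by nlinarith [sq_nonneg (h t)])]
      linarith
    rw [tendsto_zero_iff_abs_tendsto_zero]
    rw [Metric.tendsto_atTop] at h3 ⊢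
    intro ε hε
    obtain ⟨T, hT⟩ := h3 (ε ^ 3) (by positivity)
    refine ⟨T, fun t ht => ?_⟩
    have := hT t ht
    simp only [Function.comp_apply, Real.dist_eq, sub_zero, abs_pow, abs_abs] at this ⊢
    exact lt_of_pow_lt_pow_left₀ 3 hε.le this
  · set r := √q with hr
    have hr0 : 0 < r := Real.sqrt_pos.mpr hq
    have hrq : q = r ^ 2 := (Real.sq_sqrt hq.le).symm
    have hev : ∀ᶠ t in atTop, |h t * (q - h t ^ 2)| < 3 / 8 * r ^ 3 := by
      have := hlim.abs
      rw [abs_zero] at this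
      exact this.eventually (gt_mem_nhds (by positivity))
    obtain ⟨T, hT⟩ := eventually_atTop.mp (hev.and (eventually_ge_atTop 0))
    -- at `±r / 2` the cubic has the absolute value `3 r³ / 8`
    have hne : ∀ t, T ≤ t → h t ≠ r / 2 ∧ h t ≠ -(r / 2) := fun t ht => by
      have h1 := (abs_lt.mp (hT t ht).1)
      constructor <;> intro h2 <;> rw [h2, hrq] at h1 <;> nlinarith [h1.1, h1.2]
    have hpre : IsPreconnected (Ici T) := isPreconnected_Ici
    have hcT : ContinuousOn h (Ici T) := hc.mono fun t ht => (hT T le_rfl).2.trans ht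
    have hside : ∀ c, (∀ t, T ≤ t → h t ≠ c) → (∀ t, T ≤ t → h t < c) ∨ ∀ t, T ≤ t → c < h t := by
      intro c hcne
      by_contra! hcon
      obtain ⟨⟨t, ht, h1⟩, s, hs, h2⟩ := hcon
      obtain ⟨u, hu, huc⟩ := hpre.intermediate_value (mem_Ici.mpr hs) (mem_Ici.mpr ht) hcT ⟨h2, h1⟩
      exact hcne u hu huc
    -- near each root the cubic is bounded below by a multiple of the distance to the root
    have hconv : ∀ e, e * (q - e ^ 2) = 0 →
        (∀ t, T ≤ t → r ^ 2 / 2 * |h t - e| ≤ |h t * (q - h t ^ 2)|) →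
        ∃ e, e * (q - e ^ 2) = 0 ∧ Tendsto h atTop (𝓝 e) := by
      intro e he hb
      refine ⟨e, he, tendsto_iff_dist_tendsto_zero.mpr ?_⟩
      have h1 : Tendsto (fun t => 2 / r ^ 2 * |h t * (q - h t ^ 2)|) atTop (𝓝 0) := by
        simpa using hlim.abs.const_mul (2 / r ^ 2)
      refine squeeze_zero' (Eventually.of_forall fun _ => dist_nonneg) ?_ h1
      filter_upwards [eventually_ge_atTop T] with t ht
      rw [Real.dist_eq, div_mul_eq_mul_div, le_div_iff₀ (by positivity)]
      linarith [hb t ht]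
    rcases hside (r / 2) (fun t ht => (hne t ht).1) with hlt | hgt
    · rcases hside (-(r / 2)) (fun t ht => (hne t ht).2) with hlt' | hgt'
      · refine hconv (-r) (by rw [hrq]; ring) fun t ht => ?_
        have := hlt' t ht
        rw [show h t * (q - h t ^ 2) = h t * (r - h t) * (h t - -r) by rw [hrq]; ring, abs_mul]
        refine mul_le_mul_of_nonneg_right ?_ (abs_nonneg _)
        rw [abs_of_nonpos (by nlinarith)]
        nlinarith
      · refine hconv 0 (by ring) fun t ht => ?_
        have h1 := hlt t ht
        have h2 := hgt' t ht
        rw [sub_zero, abs_mul, mul_comm]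
        refine mul_le_mul_of_nonneg_left ?_ (abs_nonneg _)
        rw [hrq, abs_of_nonneg (by nlinarith)]
        nlinarith
    · refine hconv r (by rw [hrq]; ring) fun t ht => ?_
      have := hgt t ht
      rw [show h t * (q - h t ^ 2) = -(h t * (r + h t)) * (h t - r) by rw [hrq]; ring, abs_mul]
      refine mul_le_mul_of_nonneg_right ?_ (abs_nonneg _)
      rw [abs_of_nonpos (by nlinarith)]
      nlinarith

/-- If the residuals of the three equations in `mem_equilibria_lorenz` tend to zero along a
trajectory, then it converges to an equilibrium. -/
theorem lorenz_converges_of_residuals {ρ : ℝ} {x : ℝ → EuclideanSpace ℝ (Fin 3)}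
    (hx : IsTrajectory (lorenzField 10 (8 / 3) ρ) x)
    (h1 : Tendsto (fun t => x t 1 - x t 0) atTop (𝓝 0))
    (h2 : Tendsto (fun t => x t 2 - 3 / 8 * x t 0 ^ 2) atTop (𝓝 0))
    (h3 : Tendsto (fun t => x t 0 * (8 / 3 * (ρ - 1) - x t 0 ^ 2)) atTop (𝓝 0)) :
    ∃ e ∈ equilibria (lorenzField 10 (8 / 3) ρ), Tendsto x atTop (𝓝 e) := by
  obtain ⟨e, he, hlim⟩ := exists_tendsto_of_cubic (h := fun t => x t 0)
    (fun t ht => (hx.hasDerivWithinAt_apply 0 ht).continuousWithinAt) h3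
  refine ⟨!₂[e, e, 3 / 8 * e ^ 2], mem_equilibria_lorenz.mpr ⟨rfl, rfl, he⟩, ?_⟩
  have hpi : Tendsto (fun t i => x t i) atTop (𝓝 ![e, e, 3 / 8 * e ^ 2]) := by
    rw [tendsto_pi_nhds]
    intro i
    fin_cases i
    · exact hlim
    · simpa using h1.add hlim
    · have h := h2.add ((hlim.pow 2).const_mul (3 / 8))
      rw [zero_add] at h
      exact h.congr fun t => sub_add_cancel _ _
  exact ((PiLp.continuous_toLp 2 fun _ : Fin 3 => ℝ).tendsto _).comp hpi

/-! ### The Lyapunov inequality -/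

lemma continuous_intDot {E : Type*} [TopologicalSpace E] (v : List ℤ) {L : List (E → ℝ)}
    (hL : ∀ f ∈ L, Continuous f) : Continuous fun p => intDot v (L.map fun f => f p) := by
  induction v generalizing L with
  | nil => simpa [intDot] using continuous_const
  | cons a v ih =>
    cases L with
    | nil => simpa [intDot] using continuous_const
    | cons f L =>
      simp only [List.mem_cons, forall_eq_or_imp] at hL
      simp only [List.map_cons, intDot]
      exact (continuous_const.mul hL.1).add (ih hL.2)

lemma continuous_quadForm {E : Type*} [TopologicalSpace E] (R : List (List ℤ)) {L : List (E → ℝ)}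
    (hL : ∀ f ∈ L, Continuous f) : Continuous fun p => quadForm R (L.map fun f => f p) := by
  induction R generalizing L with
  | nil => simpa [quadForm] using continuous_const
  | cons r R ih =>
    match r, L with
    | [], _ => simpa [quadForm] using continuous_const
    | _ :: _, [] => simpa [quadForm] using continuous_const
    | d :: v, f :: L =>
      simp only [List.mem_cons, forall_eq_or_imp] at hL
      simp only [List.map_cons, quadForm]
      exact ((continuous_const.mul (hL.1.pow 2)).add (hL.1.mul (continuous_intDot v hL.2))).add
        (ih hL.2)

lemma continuous_quadForm_mulBasis (R : List (List ℤ)) :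
    Continuous fun p : ℝ × ℝ × ℝ => quadForm R (mulBasis p.1 p.2.1 p.2.2) :=
  continuous_quadForm R (E := ℝ × ℝ × ℝ)
    (L := [fun p => p.2.1, fun p => p.2.1 * p.2.2, fun p => p.1 * p.2.2,
      fun p => p.1 * p.2.2 ^ 2, fun p => p.1 * p.2.1 ^ 2, fun p => p.1 ^ 2 * p.2.1,
      fun p => p.1 - p.1 ^ 3, fun p => p.1 ^ 3 * p.2.2, fun p => p.1 ^ 3 - p.1 ^ 5])
    (by
      simp only [List.forall_mem_cons]
      refine ⟨?_, ?_, ?_, ?_, ?_, ?_, ?_, ?_, ?_, by simp⟩ <;> fun_prop)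

lemma continuous_quadForm_lowMulBasis (R : List (List ℤ)) (q : ℝ) :
    Continuous fun p : ℝ × ℝ × ℝ => quadForm R (lowMulBasis q p.1 p.2.1 p.2.2) :=
  continuous_quadForm R (E := ℝ × ℝ × ℝ) (L := [fun p => p.2.1, fun p => p.1 * p.2.2,
    fun p => 2 * q * p.1 - 3 * p.1 ^ 3])
    (by simp only [List.forall_mem_cons]; refine ⟨?_, ?_, ?_, by simp⟩ <;> fun_prop)

/-- If the three Bernstein coefficients of the derivative of the affine family `(1 - s) V₀ + s V₁`
on `[ω₀, ω₁]` satisfy the Lyapunov inequality, then so does the family at every `ω ∈ [ω₀, ω₁]`. -/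
lemma exists_lyapunov_of_bernstein {ω₀ ω₁ ω : ℝ} (hlt : ω₀ < ω₁) (hω : ω ∈ Icc ω₀ ω₁)
    {p₀ p₁ : List (ℤ × ℕ × ℕ × ℕ)} {M₀ M₁ M₂ : List (List ℤ)}
    (hM₀ : ∀ x y z, 0 ≤ quadForm M₀ (mulBasis x y z))
    (hM₁ : ∀ x y z, 0 ≤ quadForm M₁ (mulBasis x y z))
    (hM₂ : ∀ x y z, 0 ≤ quadForm M₂ (mulBasis x y z))
    (h₀ : ∀ x y z, y ^ 2 + z ^ 2 + (x - x ^ 3) ^ 2 + (x ^ 2 - z) * quadForm M₀ (mulBasis x y z) ≤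
      -5 * scaledLie p₀ ω₀ x y z)
    (h₁ : ∀ x y z, y ^ 2 + z ^ 2 + (x - x ^ 3) ^ 2 + (x ^ 2 - z) * quadForm M₁ (mulBasis x y z) ≤
      -5 * (scaledLie p₁ ω₀ x y z + scaledLie p₀ ω₁ x y z))
    (h₂ : ∀ x y z, y ^ 2 + z ^ 2 + (x - x ^ 3) ^ 2 + (x ^ 2 - z) * quadForm M₂ (mulBasis x y z) ≤
      -5 * scaledLie p₁ ω₁ x y z) :
    ∃ (s : ℝ) (Q : ℝ × ℝ × ℝ → ℝ), Continuous Q ∧ (∀ p, 0 ≤ Q p) ∧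
      ∀ x y z, (1 - s) * scaledLie p₀ ω x y z + s * scaledLie p₁ ω x y z ≤
        -(1 / 10 * (y ^ 2 + z ^ 2 + (x - x ^ 3) ^ 2)) - (x ^ 2 - z) * Q (x, y, z) := by
  obtain ⟨s, hs0, hs1, rfl⟩ : ∃ s, 0 ≤ s ∧ s ≤ 1 ∧ (1 - s) * ω₀ + s * ω₁ = ω := by
    have hpos : 0 < ω₁ - ω₀ := sub_pos.mpr hlt
    refine ⟨(ω - ω₀) / (ω₁ - ω₀), div_nonneg (sub_nonneg.mpr hω.1) hpos.le,
      (div_le_one hpos).mpr (by linarith [hω.2]), ?_⟩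
    field_simp
    ring
  have hs2 : 0 ≤ 1 - s := sub_nonneg.mpr hs1
  refine ⟨s, fun p =>
    1 / 5 * ((1 - s) ^ 2 * quadForm M₀ (mulBasis p.1 p.2.1 p.2.2) +
      s * (1 - s) * quadForm M₁ (mulBasis p.1 p.2.1 p.2.2) +
      s ^ 2 * quadForm M₂ (mulBasis p.1 p.2.1 p.2.2)), ?_, fun p => ?_, fun x y z => ?_⟩
  · have c₀ := continuous_quadForm_mulBasis M₀
    have c₁ := continuous_quadForm_mulBasis M₁
    have c₂ := continuous_quadForm_mulBasis M₂
    fun_prop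
  · have n₀ := hM₀ p.1 p.2.1 p.2.2
    have n₁ := hM₁ p.1 p.2.1 p.2.2
    have n₂ := hM₂ p.1 p.2.1 p.2.2
    positivity
  · rw [scaledLie_combo, scaledLie_combo]
    have e₀ := mul_le_mul_of_nonneg_left (h₀ x y z) (sq_nonneg (1 - s))
    have e₁ := mul_le_mul_of_nonneg_left (h₁ x y z) (mul_nonneg hs0 hs2)
    have e₂ := mul_le_mul_of_nonneg_left (h₂ x y z) (sq_nonneg s)
    -- the weights sum to `1 - s (1 - s)`, at least `3 / 4`
    have hs : 1 / 2 ≤ (1 - s) ^ 2 + s * (1 - s) + s ^ 2 := by nlinarith [sq_nonneg (s - 1 / 2)]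
    have hg : 0 ≤ y ^ 2 + z ^ 2 + (x - x ^ 3) ^ 2 := by positivity
    have hgs := mul_le_mul_of_nonneg_right hs hg
    simp only
    linarith

/-- Lyapunov functions for `81/20 ≤ ρ ≤ 12`. -/
lemma exists_lyapunov_scaled {ω : ℝ} (hω : ω ∈ Icc (11 / 20 : ℝ) (21 / 20)) :
    ∃ (p₀ p₁ : List (ℤ × ℕ × ℕ × ℕ)) (s : ℝ) (Q : ℝ × ℝ × ℝ → ℝ), Continuous Q ∧ (∀ p, 0 ≤ Q p) ∧
      ∀ x y z, (1 - s) * scaledLie p₀ ω x y z + s * scaledLie p₁ ω x y z ≤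
        -(1 / 10 * (y ^ 2 + z ^ 2 + (x - x ^ 3) ^ 2)) - (x ^ 2 - z) * Q (x, y, z) := by
  rcases le_total ω 1 with h1 | h1
  · refine ⟨midLyap0, midLyap1, exists_lyapunov_of_bernstein (by norm_num) ⟨hω.1, h1⟩
      midGram0Mul_nonneg midGram1Mul_nonneg midGram2Mul_nonneg (fun x y z => ?_)
      (fun x y z => ?_) (fun x y z => ?_)⟩
    · linarith [scaledLie_mid_bernstein0 x y z, midGram0Odd_nonneg x y z,
        midGram0Even_nonneg x y z]
    · linarith [scaledLie_mid_bernstein1 x y z, midGram1Odd_nonneg x y z,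
        midGram1Even_nonneg x y z]
    · linarith [scaledLie_mid_bernstein2 x y z, midGram2Odd_nonneg x y z,
        midGram2Even_nonneg x y z]
  · refine ⟨highLyap0, highLyap1, exists_lyapunov_of_bernstein (by norm_num) ⟨h1, hω.2⟩
      highGram0Mul_nonneg highGram1Mul_nonneg highGram2Mul_nonneg (fun x y z => ?_)
      (fun x y z => ?_) (fun x y z => ?_)⟩
    · linarith [scaledLie_high_bernstein0 x y z, highGram0Odd_nonneg x y z,
        highGram0Even_nonneg x y z]
    · linarith [scaledLie_high_bernstein1 x y z, highGram1Odd_nonneg x y z,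
        highGram1Even_nonneg x y z]
    · linarith [scaledLie_high_bernstein2 x y z, highGram2Odd_nonneg x y z,
        highGram2Even_nonneg x y z]

/-- The Lyapunov function for `0 ≤ ρ ≤ 81/20`, with `q = ρ - 1`. -/
lemma lyapunov_low {q : ℝ} (hq : q ∈ Icc (-1 : ℝ) (61 / 20)) :
    ∃ Q : ℝ × ℝ × ℝ → ℝ, Continuous Q ∧ (∀ p, 0 ≤ Q p) ∧
      ∀ x y z, lowLie lowLyap0 q x y z + q * lowLie lowLyap1 q x y z +
          q ^ 2 * lowLie lowLyap2 q x y z ≤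
        -(1 / 500 * (y ^ 2 + z ^ 2 + (2 * q * x - 3 * x ^ 3) ^ 2)) -
          (13 * x ^ 2 - 10 * z) * Q (x, y, z) := by
  have hq0 : 0 ≤ q + 1 := by linarith [hq.1]
  have hq1 : 0 ≤ 61 - 20 * q := by linarith [hq.2]
  refine ⟨fun p => 1 / 1620 *
    ((61 - 20 * q) * quadForm lowGram0Mul (lowMulBasis q p.1 p.2.1 p.2.2) +
      (q + 1) * quadForm lowGram1Mul (lowMulBasis q p.1 p.2.1 p.2.2)), ?_, fun p => ?_,
    fun x y z => ?_⟩
  · have h0 := continuous_quadForm_lowMulBasis lowGram0Mul q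
    have h1 := continuous_quadForm_lowMulBasis lowGram1Mul q
    fun_prop
  · have h0 := lowGram0Mul_nonneg q p.1 p.2.1 p.2.2
    have h1 := lowGram1Mul_nonneg q p.1 p.2.1 p.2.2
    positivity
  · have e := lowLie_lowLyap q x y z
    have a0 := mul_nonneg hq1
      (add_nonneg (lowGram0Odd_nonneg q x y z) (lowGram0Even_nonneg q x y z))
    have a1 := mul_nonneg hq0
      (add_nonneg (lowGram1Odd_nonneg q x y z) (lowGram1Even_nonneg q x y z))
    have hg : 0 ≤ y ^ 2 + z ^ 2 + (2 * q * x - 3 * x ^ 3) ^ 2 := by positivity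
    -- the sum of the weights is `62 - 19 q`, and `4 / 1620 > 1 / 500`
    have hgs := mul_le_mul_of_nonneg_right
      (show (4 : ℝ) ≤ (61 - 20 * q) + (q + 1) by linarith [hq.2]) hg
    simp only
    linarith

/-! ### Convergence -/

lemma tendsto_zero_of_sum_sq {a b c : ℝ → ℝ} {k : ℝ} (hk : 0 < k)
    (h : Tendsto (fun t => k * (a t ^ 2 + b t ^ 2 + c t ^ 2)) atTop (𝓝 0)) :
    Tendsto a atTop (𝓝 0) ∧ Tendsto b atTop (𝓝 0) ∧ Tendsto c atTop (𝓝 0) := by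
  have aux : ∀ f : ℝ → ℝ, (∀ t, f t ^ 2 ≤ a t ^ 2 + b t ^ 2 + c t ^ 2) →
      Tendsto f atTop (𝓝 0) := fun f hf => by
    have h1 : Tendsto (fun t => k⁻¹ * (k * (a t ^ 2 + b t ^ 2 + c t ^ 2))) atTop (𝓝 0) := by
      simpa using h.const_mul k⁻¹
    have h2 : Tendsto (fun t => f t ^ 2) atTop (𝓝 0) :=
      squeeze_zero (fun t => sq_nonneg _) (fun t => by
        rw [inv_mul_cancel_left₀ hk.ne']; exact hf t) h1
    rw [tendsto_zero_iff_abs_tendsto_zero]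
    simpa [Real.sqrt_sq_eq_abs, Function.comp_def] using h2.sqrt
  refine ⟨aux a fun t => ?_, aux b fun t => ?_, aux c fun t => ?_⟩ <;>
    nlinarith [sq_nonneg (a t), sq_nonneg (b t), sq_nonneg (c t)]

section

variable {ρ : ℝ} {x : ℝ → EuclideanSpace ℝ (Fin 3)}

theorem lorenz_converges_low (hx : IsTrajectory (lorenzField 10 (8 / 3) ρ) x) (h0 : 0 ≤ ρ)
    (h1 : ρ ≤ 81 / 20) :
    ∃ e ∈ equilibria (lorenzField 10 (8 / 3) ρ), Tendsto x atTop (𝓝 e) := by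
  set q := ρ - 1 with hq
  obtain ⟨Q, hQ, hQ0, hdec⟩ := lyapunov_low (q := q) ⟨by linarith, by linarith⟩
  obtain ⟨R, hR⟩ := lorenz_bounded hx
  let X : EuclideanSpace ℝ (Fin 3) → ℝ := fun p => p 0 / 2
  let Y : EuclideanSpace ℝ (Fin 3) → ℝ := fun p => (p 1 - p 0) / 2
  let Z : EuclideanSpace ℝ (Fin 3) → ℝ := fun p => 3 / 8 * p 0 ^ 2 - p 2
  have hXYZ : Continuous fun p => (X p, Y p, Z p) := by fun_prop
  have hX' : ∀ t, 0 ≤ t → HasDerivWithinAt (fun t => X (x t))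
      (1 / 6 * (60 * Y (x t))) (Ici 0) t := fun t ht => by
    refine ((hx.hasDerivWithinAt_apply 0 ht).div_const 2).congr_deriv ?_
    simp only [lorenzField_zero, Y]
    ring
  have hY' : ∀ t, 0 ≤ t → HasDerivWithinAt (fun t => Y (x t))
      (1 / 6 * (-66 * Y (x t) + 6 * q * X (x t) - 9 * X (x t) ^ 3 + 6 * X (x t) * Z (x t)))
      (Ici 0) t := fun t ht => by
    refine (((hx.hasDerivWithinAt_apply 1 ht).sub (hx.hasDerivWithinAt_apply 0 ht)).div_const
      2).congr_deriv ?_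
    simp only [lorenzField_zero, lorenzField_one, X, Y, Z, hq]
    ring
  have hZ' : ∀ t, 0 ≤ t → HasDerivWithinAt (fun t => Z (x t))
      (1 / 6 * (-16 * Z (x t) + 156 * X (x t) * Y (x t))) (Ici 0) t := fun t ht => by
    refine ((((hx.hasDerivWithinAt_apply 0 ht).pow 2).const_mul (3 / 8)).sub
      (hx.hasDerivWithinAt_apply 2 ht)).congr_deriv ?_
    simp only [lorenzField_zero, lorenzField_two, X, Y, Z]
    push_cast
    ring
  have hV' : ∀ (p : List (ℤ × ℕ × ℕ × ℕ)) (t : ℝ), 0 ≤ t →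
      HasDerivWithinAt (fun t => polyEval p (X (x t)) (Y (x t)) (Z (x t)))
        (1 / 6 * lowLie p q (X (x t)) (Y (x t)) (Z (x t))) (Ici 0) t := fun p t ht => by
    rw [lowLie, ← polyDeriv_smul]
    exact hasDerivWithinAt_polyEval p (hX' t ht) (hY' t ht) (hZ' t ht)
  have hVc : ∀ p : List (ℤ × ℕ × ℕ × ℕ), Continuous fun u => polyEval p (X u) (Y u) (Z u) :=
    fun p => (continuous_polyEval p).comp hXYZ
  have hlim := tendsto_zero_of_lyapunov (contDiff_lorenzField 10 (8 / 3) ρ).continuous hx hR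
    (V := fun u => polyEval lowLyap0 (X u) (Y u) (Z u) + q * polyEval lowLyap1 (X u) (Y u) (Z u) +
      q ^ 2 * polyEval lowLyap2 (X u) (Y u) (Z u))
    (V' := fun u => 1 / 6 * lowLie lowLyap0 q (X u) (Y u) (Z u) +
      q * (1 / 6 * lowLie lowLyap1 q (X u) (Y u) (Z u)) +
      q ^ 2 * (1 / 6 * lowLie lowLyap2 q (X u) (Y u) (Z u)))
    (g := fun u => 1 / 3000 * (Y u ^ 2 + Z u ^ 2 + (2 * q * X u - 3 * X u ^ 3) ^ 2))
    (w := fun u => u 2 - u 0 ^ 2 / 20) (Q := fun u => 10 / 6 * Q (X u, Y u, Z u))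
    (((hVc _).add ((hVc _).const_mul q)).add ((hVc _).const_mul (q ^ 2)))
    (by fun_prop) ((hQ.comp hXYZ).const_mul _) (fun u => by positivity)
    (fun u => by have := hQ0 (X u, Y u, Z u); positivity)
    (fun t ht =>
      ((hV' _ t ht).add ((hV' _ t ht).const_mul q)).add ((hV' _ t ht).const_mul (q ^ 2)))
    (fun u => by
      have h := hdec (X u) (Y u) (Z u)
      have hw : 13 * X u ^ 2 - 10 * Z u = 10 * (u 2 - u 0 ^ 2 / 20) := by
        simp only [X, Z]
        ring
      rw [hw] at h
      simp only
      linarith)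
    (abs_nonneg _) (k := 8 / 3) (by norm_num) (fun t ht => lorenz_lower_bound hx ht)
  obtain ⟨l1, l2, l3⟩ := tendsto_zero_of_sum_sq (by norm_num) hlim
  refine lorenz_converges_of_residuals hx ?_ ?_ ?_
  · refine (by simpa using l1.const_mul 2 :
      Tendsto (fun t => 2 * Y (x t)) atTop (𝓝 0)).congr fun t => ?_
    simp only [Y]
    ring
  · refine (by simpa using l2.neg :
      Tendsto (fun t => -Z (x t)) atTop (𝓝 0)).congr fun t => ?_
    simp only [Z]
    ring
  · refine (by simpa using l3.const_mul (8 / 3) :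
      Tendsto (fun t => 8 / 3 * (2 * q * X (x t) - 3 * X (x t) ^ 3)) atTop (𝓝 0)).congr fun t => ?_
    simp only [X]
    ring

theorem lorenz_converges_high (hx : IsTrajectory (lorenzField 10 (8 / 3) ρ) x) (h0 : 81 / 20 ≤ ρ)
    (h1 : ρ ≤ 12) :
    ∃ e ∈ equilibria (lorenzField 10 (8 / 3) ρ), Tendsto x atTop (𝓝 e) := by
  set ω := √((ρ - 1) / 10) with hω
  have hω2 : ω ^ 2 = (ρ - 1) / 10 := Real.sq_sqrt (by linarith)
  have hωl : 11 / 20 ≤ ω := Real.le_sqrt_of_sq_le (by linarith)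
  have hωu : ω ≤ 21 / 20 := Real.sqrt_le_iff.mpr ⟨by norm_num, by linarith⟩
  have hω0 : 0 < ω := by linarith
  have hρ : ρ = 10 * ω ^ 2 + 1 := by linarith
  set r := √(80 / 3 : ℝ) with hr
  have hr2 : r ^ 2 = 80 / 3 := Real.sq_sqrt (by norm_num)
  have hr0 : 0 < r := Real.sqrt_pos.mpr (by norm_num)
  have hr3 : r ^ 3 = 80 / 3 * r := by rw [pow_succ, hr2]
  obtain ⟨p₀, p₁, s, Q, hQ, hQ0, hdec⟩ := exists_lyapunov_scaled ⟨hωl, hωu⟩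
  obtain ⟨R, hR⟩ := lorenz_bounded hx
  let X : EuclideanSpace ℝ (Fin 3) → ℝ := fun p => p 0 / (r * ω)
  let Y : EuclideanSpace ℝ (Fin 3) → ℝ := fun p => (p 1 - p 0) / (r * ω ^ 2)
  let Z : EuclideanSpace ℝ (Fin 3) → ℝ := fun p => (9 * p 0 ^ 2 - 24 * p 2) / (208 * ω ^ 2)
  have hXYZ : Continuous fun p => (X p, Y p, Z p) := by fun_prop
  have hX' : ∀ t, 0 ≤ t → HasDerivWithinAt (fun t => X (x t))
      (1 / 6 * (60 * ω * Y (x t))) (Ici 0) t := fun t ht => by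
    refine ((hx.hasDerivWithinAt_apply 0 ht).div_const (r * ω)).congr_deriv ?_
    simp only [lorenzField_zero, Y]
    field_simp
    ring
  have hY' : ∀ t, 0 ≤ t → HasDerivWithinAt (fun t => Y (x t))
      (1 / 6 * (-66 * Y (x t) + ω * (60 * (X (x t) - X (x t) ^ 3) + 52 * X (x t) * Z (x t))))
      (Ici 0) t := fun t ht => by
    refine (((hx.hasDerivWithinAt_apply 1 ht).sub (hx.hasDerivWithinAt_apply 0 ht)).div_const
      (r * ω ^ 2)).congr_deriv ?_
    simp only [lorenzField_zero, lorenzField_one, X, Y, Z, div_pow, mul_pow, hr3]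
    rw [hρ]
    field_simp
    ring
  have hZ' : ∀ t, 0 ≤ t → HasDerivWithinAt (fun t => Z (x t))
      (1 / 6 * (-16 * Z (x t) + 120 * ω * X (x t) * Y (x t))) (Ici 0) t := fun t ht => by
    refine (((((hx.hasDerivWithinAt_apply 0 ht).pow 2).const_mul 9).sub
      ((hx.hasDerivWithinAt_apply 2 ht).const_mul 24)).div_const (208 * ω ^ 2)).congr_deriv ?_
    have hXY : ω * X (x t) * Y (x t) = x t 0 * (x t 1 - x t 0) / (80 / 3 * ω ^ 2) := by
      rw [← hr2]
      simp only [X, Y]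
      field_simp
    rw [show 120 * ω * X (x t) * Y (x t) = 120 * (ω * X (x t) * Y (x t)) by ring, hXY]
    simp only [lorenzField_zero, lorenzField_two, Z]
    push_cast
    field_simp
    ring
  have hV' : ∀ (p : List (ℤ × ℕ × ℕ × ℕ)) (t : ℝ), 0 ≤ t →
      HasDerivWithinAt (fun t => polyEval p (X (x t)) (Y (x t)) (Z (x t)))
        (1 / 6 * scaledLie p ω (X (x t)) (Y (x t)) (Z (x t))) (Ici 0) t := fun p t ht => by
    rw [scaledLie, ← polyDeriv_smul]
    exact hasDerivWithinAt_polyEval p (hX' t ht) (hY' t ht) (hZ' t ht)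
  have hVc : ∀ p : List (ℤ × ℕ × ℕ × ℕ), Continuous fun u => polyEval p (X u) (Y u) (Z u) :=
    fun p => (continuous_polyEval p).comp hXYZ
  have hlim := tendsto_zero_of_lyapunov (contDiff_lorenzField 10 (8 / 3) ρ).continuous hx hR
    (V := fun u => (1 - s) * polyEval p₀ (X u) (Y u) (Z u) + s * polyEval p₁ (X u) (Y u) (Z u))
    (V' := fun u => (1 - s) * (1 / 6 * scaledLie p₀ ω (X u) (Y u) (Z u)) +
      s * (1 / 6 * scaledLie p₁ ω (X u) (Y u) (Z u)))
    (g := fun u => 1 / 60 * (Y u ^ 2 + Z u ^ 2 + (X u - X u ^ 3) ^ 2))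
    (w := fun u => u 2 - u 0 ^ 2 / 20) (Q := fun u => 1 / (52 * ω ^ 2) * Q (X u, Y u, Z u))
    (((hVc _).const_mul (1 - s)).add ((hVc _).const_mul s))
    (by fun_prop) ((hQ.comp hXYZ).const_mul _) (fun u => by positivity)
    (fun u => by have := hQ0 (X u, Y u, Z u); positivity)
    (fun t ht => ((hV' _ t ht).const_mul (1 - s)).add ((hV' _ t ht).const_mul s))
    (fun u => by
      have h := hdec (X u) (Y u) (Z u)
      have hw : (X u ^ 2 - Z u) = 6 * ((u 2 - u 0 ^ 2 / 20) * (1 / (52 * ω ^ 2))) := by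
        simp only [X, Z, div_pow, mul_pow, hr2]
        field_simp
        ring
      rw [hw] at h
      simp only
      linarith)
    (abs_nonneg _) (k := 8 / 3) (by norm_num) (fun t ht => lorenz_lower_bound hx ht)
  obtain ⟨l1, l2, l3⟩ := tendsto_zero_of_sum_sq (by norm_num) hlim
  refine lorenz_converges_of_residuals hx ?_ ?_ ?_
  · refine (by simpa using l1.const_mul (r * ω ^ 2) :
      Tendsto (fun t => r * ω ^ 2 * Y (x t)) atTop (𝓝 0)).congr fun t => ?_
    simp only [Y]
    field_simp
  · refine (by simpa using l2.const_mul (-(26 / 3 * ω ^ 2)) :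
      Tendsto (fun t => -(26 / 3 * ω ^ 2) * Z (x t)) atTop (𝓝 0)).congr fun t => ?_
    simp only [Z]
    field_simp
    ring
  · refine (by simpa using l3.const_mul (80 / 3 * r * ω ^ 3) :
      Tendsto (fun t => 80 / 3 * r * ω ^ 3 * (X (x t) - X (x t) ^ 3)) atTop (𝓝 0)).congr fun t => ?_
    simp only [X, div_pow, mul_pow, hr3, hρ]
    field_simp
    ring

theorem globallyStable_lorenz (hρ : ρ ∈ Icc (0 : ℝ) 12) :
    GloballyStable (lorenzField 10 (8 / 3) ρ) where
  exists_trajectory := lorenz_exists_trajectory ρ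
  converges x hx := by
    rcases le_total ρ (81 / 20) with h | h
    · exact lorenz_converges_low hx hρ.1 h
    · exact lorenz_converges_high hx h hρ.2

end

/-! ### Periodic orbits and chaos -/

section

variable {E : Type*} [NormedAddCommGroup E] [NormedSpace ℝ E] {f : E → E}

lemma IsPeriodicTrajectory.eq_of_tendsto {x : ℝ → E} (hx : IsPeriodicTrajectory f x) {e : E}
    (he : Tendsto x atTop (𝓝 e)) {t : ℝ} (ht : 0 ≤ t) : x t = e := by
  obtain ⟨-, T, hT, hper⟩ := hx
  have hn : ∀ n : ℕ, x (t + n * T) = x t := by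
    intro n
    induction n with
    | zero => simp
    | succ n ih =>
      rw [← ih, ← hper (t + n * T) (by positivity)]
      congr 1
      push_cast
      ring
  have hlim : Tendsto (fun n : ℕ => t + n * T) atTop atTop :=
    tendsto_atTop_add_const_left _ _ (tendsto_natCast_atTop_atTop.atTop_mul_const hT)
  exact tendsto_nhds_unique ((tendsto_const_nhds (x := x t)).congr fun n => (hn n).symm)
    (he.comp hlim)

theorem GloballyStable.not_isPeriodicOrbit (h : GloballyStable f) (x : ℝ → E) :
    ¬ IsPeriodicOrbit f x := by
  rintro ⟨hx, t, ht, hne⟩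
  obtain ⟨e, -, he⟩ := h.converges x hx.1
  exact hne ((hx.eq_of_tendsto he ht).trans (hx.eq_of_tendsto he le_rfl).symm)

/-- In a chaotic set of a globally stable system the periodic points are equilibria; if there are
only finitely many equilibria, they cannot be left by any trajectory, against sensitivity. -/
theorem GloballyStable.not_isDevaneyChaotic [FiniteDimensional ℝ E] (h : GloballyStable f)
    (hf : ContDiff ℝ 1 f) (hfin : (equilibria f).Finite) (Λ : Set E) : ¬ IsDevaneyChaotic f Λ := by
  intro hΛ
  have hper : periodicPointsIn f Λ ⊆ equilibria f := by
    rintro p ⟨-, x, hx, rfl⟩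
    obtain ⟨e, he, hlim⟩ := h.converges x hx.1
    rwa [hx.eq_of_tendsto hlim le_rfl]
  have hsub : Λ ⊆ equilibria f :=
    hΛ.dense_periodic.trans (closure_minimal hper hfin.isClosed)
  obtain ⟨p, hp⟩ := hΛ.nonempty
  obtain ⟨δ, hδ, hsens⟩ := hΛ.sensitive
  -- a ball around `p` that contains no other equilibrium
  obtain ⟨ε, hε, hball⟩ := Metric.isOpen_iff.mp (hfin.subset sdiff_subset).isClosed.isOpen_compl p
    (show p ∈ (equilibria f \ {p})ᶜ from fun h => h.2 rfl)
  obtain ⟨x, y, hx, hy, hx0, hyΛ, hd, t, ht, hlt⟩ := hsens p hp ε hε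
  have hy0 : y 0 = p := by
    by_contra hne
    exact hball (Metric.mem_ball.mpr hd) ⟨hsub hyΛ, hne⟩
  have hfp : f p = 0 := hsub hp
  rw [hx.eq_of_equilibrium hf (by rwa [hx0]) ht, hy.eq_of_equilibrium hf (by rwa [hy0]) ht, hx0,
    hy0, dist_self] at hlt
  linarith

end

theorem mainTheorem1 (ρ : ℝ) (hρ : ρ ∈ Set.Icc (0 : ℝ) 12) :
    GloballyStable (lorenzField 10 (8 / 3) ρ) ∧
    (¬ ∃ x : ℝ → EuclideanSpace ℝ (Fin 3), IsPeriodicOrbit (lorenzField 10 (8 / 3) ρ) x) ∧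
    (¬ ∃ Λ : Set (EuclideanSpace ℝ (Fin 3)), IsDevaneyChaotic (lorenzField 10 (8 / 3) ρ) Λ) := by
  have h := globallyStable_lorenz hρ
  exact ⟨h, fun ⟨x, hx⟩ => h.not_isPeriodicOrbit x hx, fun ⟨Λ, hΛ⟩ =>
    h.not_isDevaneyChaotic (contDiff_lorenzField _ _ _) (finite_equilibria_lorenz ρ) Λ hΛ⟩
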